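/- Let $\chi_A,\chi_B,\chi_C\ge 1$ be integers with $\chi_C<\chi_A\chi_B$, let $\mathcal H_A,\mathcal H_B,\mathcal H_C$ be complex Hilbert spaces of these dimensions, and let $|\psi\rangle=U|\psi_0\rangle\in\mathcal H_A\otimes\mathcal H_B\otimes\mathcal H_C$ be a Haar-random state: $|\psi_0\rangle$ is a fixed unit vector and $U$ is distributed according to the Haar probability measure on the unitary group $U(\chi_A\chi_B\chi_C)$. An overline denotes the expectation over $U$. Put $\rho_{AB}=\mathrm{Tr}_C|\psi\rangle\langle\psi|$ and, for $m\ge 1$, let $$\rho^{(m)}_{AA^\star}=\frac{1}{\mathrm{Tr}\,\rho_{AB}^m}\,\mathrm{Tr}_{BB^\star}\big|\rho_{AB}^{m/2}\big\rangle\big\langle\rho_{AB}^{m/2}\big|,$$ where the operator $\rho_{AB}^{m/2}$ on $\mathcal H_A\otimes\mathcal H_B$ is regarded as a vector in $(\mathcal H_A\otimes\mathcal H_A^\star)\otimes(\mathcal H_B\otimes\mathcal H_B^\star)$. The $(m,n)$-Rényi reflected entropy of $\psi$ is $$S_R^{(m,n)}(A:B)=-\frac{1}{n-1}\ln\mathrm{Tr}\big(\rho^{(m)}_{AA^\star}\big)^n\quad(n>1),\qquad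 S_R^{(m,1)}(A:B)=-\mathrm{Tr}\,\rho^{(m)}_{AA^\star}\ln\rho^{(m)}_{AA^\star},$$ and $S_R(A:B)=S_R^{(1,1)}(A:B)$ is the reflected entropy. Then for all real $1\le m\le 2$ and $n>1$, $$\overline{\left|S_R^{(1,n)}(A:B)-S_R^{(m,n)}(A:B)\right|}\le\frac{2n}{n-1}\left(\frac{(m-1)\chi_C}{\chi_A\chi_B}\right)^{1/2}\min\{\chi_A^{2(n-1)},\chi_B^{2(n-1)}\},$$ and for all real $1\le m\le 2$, $$\overline{\left|S_R(A:B)-S_R^{(m,1)}(A:B)\right|}<2\left(\frac{(m-1)\chi_C}{\chi_A\chi_B}\right)^{1/2}\min\{\ln\chi_A,\ln\chi_B\}+\ln 2.$$ In both cases the averaged function of $U$ is integrable. -/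

import Mathlib

open MeasureTheory Matrix

namespace Reflected

variable {A B C X Y : Type*}

/-! ## Linear algebra of finite-dimensional quantum systems -/

section LinearAlgebra

variable [Fintype A] [Fintype B] [Fintype C] [Fintype X] [Fintype Y]

/-- The rank-one operator `|v⟩⟨v|`. -/
def ketBra (v : X → ℂ) : Matrix X X ℂ := vecMulVec v (star v)

/-- The partial trace over the second tensor factor. -/
def partialTrace (M : Matrix (X × Y) (X × Y) ℂ) : Matrix X X ℂ :=
  of fun i j => ∑ k, M (i, k) (j, k)

/-- The reduced density matrix `ρ_{AB} = Tr_C |ψ⟩⟨ψ|` of a tripartite state vector `ψ`. -/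
def rhoAB (ψ : A × B × C → ℂ) : Matrix (A × B) (A × B) ℂ :=
  partialTrace (ketBra fun p : (A × B) × C => ψ (p.1.1, p.1.2, p.2))

/-- The real power `ρ ^ s` of a positive semidefinite matrix, by functional calculus. -/
noncomputable def matPow [DecidableEq X] (ρ : Matrix X X ℂ) (s : ℝ) : Matrix X X ℂ :=
  cfc (fun x : ℝ => x ^ s) ρ

/-- An operator `M` on `A ⊗ B`, regarded as a vector `|M⟩` of `(A ⊗ A⋆) ⊗ (B ⊗ B⋆)`. -/
def opVec (M : Matrix (A × B) (A × B) ℂ) : (A × A) × (B × B) → ℂ :=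
  fun p => M (p.1.1, p.2.1) (p.1.2, p.2.2)

/-- `ρ_{AA⋆}^{(m)} = (Tr ρ ^ m)⁻¹ Tr_{BB⋆} |ρ ^ (m/2)⟩⟨ρ ^ (m/2)|`, for `ρ` on `A ⊗ B`. -/
noncomputable def rhoAAstar [DecidableEq A] [DecidableEq B]
    (m : ℝ) (ρ : Matrix (A × B) (A × B) ℂ) : Matrix (A × A) (A × A) ℂ :=
  (matPow ρ m).trace⁻¹ • partialTrace (ketBra (opVec (matPow ρ (m / 2))))

/-- The von Neumann entropy `-Tr σ ln σ`. -/
noncomputable def vonNeumannEntropy [DecidableEq X] (σ : Matrix X X ℂ) : ℝ :=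
  (cfc Real.negMulLog σ).trace.re

/-- The Rényi entropy `S_n(σ) = -(n-1)⁻¹ ln Tr σ ^ n`; at `n = 1`, the von Neumann entropy. -/
noncomputable def renyiEntropy [DecidableEq X] (n : ℝ) (σ : Matrix X X ℂ) : ℝ :=
  if n = 1 then vonNeumannEntropy σ
  else -(1 / (n - 1)) * Real.log (matPow σ n).trace.re

/-- The `(m,n)`-Rényi reflected entropy `S_R^{(m,n)}(A:B)` of a tripartite state vector. The
reflected entropy `S_R(A:B)` is the case `m = n = 1`. -/
noncomputable def reflectedEntropy [DecidableEq A] [DecidableEq B]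
    (m n : ℝ) (ψ : A × B × C → ℂ) : ℝ :=
  renyiEntropy n (rhoAAstar m (rhoAB ψ))

end LinearAlgebra

/-! ## The Haar probability measure on the unitary group -/

section Haar

variable [Fintype X] [DecidableEq X]

/-- The Borel σ-algebra of the unitary group. -/
noncomputable instance : MeasurableSpace (unitaryGroup X ℂ) := borel _

instance : BorelSpace (unitaryGroup X ℂ) := ⟨rfl⟩

instance : CompactSpace (unitaryGroup X ℂ) := by
  refine isCompact_iff_compactSpace.mp ?_
  have hb : IsCompact (Set.pi Set.univ fun _ : X => Set.pi Set.univ fun _ : X =>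
      Metric.closedBall (0 : ℂ) 1) :=
    isCompact_univ_pi fun _ => isCompact_univ_pi fun _ => isCompact_closedBall _ _
  refine IsCompact.of_isClosed_subset (X := Matrix X X ℂ) hb ?_ ?_
  · exact isClosed_unitary
  · intro U hU i _ j _
    simpa using entry_norm_bound_of_unitary hU i j

/-- The Haar measure on the unitary group, normalised to total mass one. -/
noncomputable def haarUnitary (X : Type*) [Fintype X] [DecidableEq X] :
    Measure (unitaryGroup X ℂ) :=
  Measure.haarMeasure ⊤

instance : IsProbabilityMeasure (haarUnitary X) :=
  ⟨by simpa [haarUnitary] using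
    Measure.haarMeasure_self (K₀ := (⊤ : TopologicalSpace.PositiveCompacts (unitaryGroup X ℂ)))⟩

end Haar

end Reflected

namespace Reflected

/-! ## Inequalities for finite probability distributions -/

section Classical

variable {X : Type*} [Fintype X]

/-! Write `ρ` for `ρ_{AB}`, of rank at most `χC`. The states `ρ_{AA⋆}^{(1)}` and `ρ_{AA⋆}^{(m)}`
have purifications `ρ ^ (1/2)` and `ρ ^ (m/2)`, normalised, with squared overlap `F = (Tr ρ ^
((1+m)/2))² / Tr ρ ^ m`. A power-mean bound on the support of `ρ` gives `(Tr ρ ^ ((1+m)/2))² ≥ χC ^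
(1-m)`. Jensen's inequality for `x ^ (m-1)` gives `Tr ρ ^ m ≤ (Tr ρ²) ^ (m-1)`. Bernoulli's
inequality then yields `1 - F ≤ (m-1)(χC Tr ρ² - 1)` (`one_sub_overlap_le`).

Two states whose purifications have overlap at least `s` have close entropies. Measuring both in an
eigenbasis of one of them (`exists_pinching`) leaves two classical distributions at total variation
distance at most `√(1 - s²)`, and can only increase the entropy of the other. What remains is
classical: a Fannes-type estimate (`sum_negMulLog_sub_le`) for `n = 1`, a Lipschitz estimate for `∑
p ^ n` (`sum_rpow_sub_le`) for `n > 1`. A state and its complement `M Mᴴ`, `Mᴴ M` share their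
nonzero spectrum, so the dimension may be taken on either side, whence the minimum over `A` and `B`.

Finally, the average of `√(1 - F)` is bounded through Jensen by the mean purity (`integral_purity`),
for which the mean of `χC Tr ρ² - 1` is `(χC² - 1)/(χA χB χC + 1) < χC/(χA χB)`. Integrability
follows from continuity on the compact unitary group. -/

lemma negMulLog_add_le {x y : ℝ} (hx : 0 ≤ x) (hy : 0 ≤ y) :
    Real.negMulLog (x + y) ≤ Real.negMulLog x + Real.negMulLog y := by
  rcases hx.eq_or_lt with rfl | hx'
  · simp
  rcases hy.eq_or_lt with rfl | hy'
  · simp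
  have h1 := Real.log_le_log hx' (by linarith : x ≤ x + y)
  have h2 := Real.log_le_log hy' (by linarith : y ≤ x + y)
  simp only [Real.negMulLog]
  nlinarith

lemma sum_negMulLog_le_card [Nonempty X] (a : X → ℝ) (ha : ∀ i, 0 ≤ a i) :
    ∑ i, Real.negMulLog (a i)
      ≤ (∑ i, a i) * Real.log (Fintype.card X) + Real.negMulLog (∑ i, a i) := by
  have hD : (0 : ℝ) < Fintype.card X := by exact_mod_cast Fintype.card_pos
  have h := Real.concaveOn_negMulLog.le_map_sum (t := Finset.univ)
    (w := fun _ : X => (Fintype.card X : ℝ)⁻¹) (p := a) (fun _ _ => by positivity)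
    (by simp [hD.ne']) (fun i _ => ha i)
  simp only [smul_eq_mul, ← Finset.mul_sum] at h
  rw [Real.negMulLog_mul] at h
  have h' := mul_le_mul_of_nonneg_left h hD.le
  rw [← mul_assoc, mul_inv_cancel₀ hD.ne', one_mul] at h'
  refine h'.trans (le_of_eq ?_)
  simp only [Real.negMulLog, Real.log_inv]
  field_simp

/-- Both distributions contain the common part `r = min p q` of mass `1 - T`, with remainders `a`,
`b` of mass `T`. Subadditivity bounds the entropy of `p = r + a` from above; concavity bounds that
of the mixture `q = r + b` from below. -/
lemma sum_negMulLog_sub_le [Nonempty X] (p q : X → ℝ) (hp : ∀ i, 0 ≤ p i) (hq : ∀ i, 0 ≤ q i)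
    (hps : ∑ i, p i = 1) (hqs : ∑ i, q i = 1) :
    ∑ i, Real.negMulLog (p i) - ∑ i, Real.negMulLog (q i)
      ≤ (∑ i, |p i - q i|) / 2 * Real.log (Fintype.card X)
        + Real.binEntropy ((∑ i, |p i - q i|) / 2) := by
  set T := (∑ i, |p i - q i|) / 2 with hT
  set r : X → ℝ := fun i => min (p i) (q i) with hr
  set a : X → ℝ := fun i => p i - r i with ha
  set b : X → ℝ := fun i => q i - r i with hb
  have hr0 : ∀ i, 0 ≤ r i := fun i => le_min (hp i) (hq i)
  have ha0 : ∀ i, 0 ≤ a i := fun i => sub_nonneg.2 (min_le_left _ _)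
  have hb0 : ∀ i, 0 ≤ b i := fun i => sub_nonneg.2 (min_le_right _ _)
  have hab : ∑ i, a i - ∑ i, b i = 0 := by
    rw [← Finset.sum_sub_distrib]
    have : ∑ i, (a i - b i) = ∑ i, p i - ∑ i, q i := by
      rw [← Finset.sum_sub_distrib]; exact Finset.sum_congr rfl fun i _ => by simp [ha, hb]
    rw [this, hps, hqs, sub_self]
  have hab' : ∑ i, a i + ∑ i, b i = 2 * T := by
    rw [← Finset.sum_add_distrib, hT, mul_div_cancel₀ _ two_ne_zero]
    refine Finset.sum_congr rfl fun i _ => ?_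
    simp only [ha, hb, hr]
    rcases le_total (p i) (q i) with h | h
    · rw [min_eq_left h, abs_of_nonpos (by linarith)]; ring
    · rw [min_eq_right h, abs_of_nonneg (by linarith)]; ring
  have hTa : ∑ i, a i = T := by linarith
  have hTb : ∑ i, b i = T := by linarith
  have hTr : ∑ i, r i = 1 - T := by
    rw [← hTa, ← hps, ← Finset.sum_sub_distrib]
    exact Finset.sum_congr rfl fun i _ => by simp [ha]
  have hT0 : 0 ≤ T := hTa ▸ Finset.sum_nonneg fun i _ => ha0 i
  have hT1 : T ≤ 1 := by
    have : 0 ≤ ∑ i, r i := Finset.sum_nonneg fun i _ => hr0 i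
    linarith
  have hupper : ∑ i, Real.negMulLog (p i) ≤ ∑ i, Real.negMulLog (r i)
      + (T * Real.log (Fintype.card X) + Real.negMulLog T) := by
    have h1 : ∑ i, Real.negMulLog (p i)
        ≤ ∑ i, (Real.negMulLog (r i) + Real.negMulLog (a i)) := by
      refine Finset.sum_le_sum fun i _ => ?_
      have := negMulLog_add_le (hr0 i) (ha0 i)
      simpa [ha] using this
    rw [Finset.sum_add_distrib] at h1
    have := sum_negMulLog_le_card a ha0
    rw [hTa] at this
    linarith
  have hlower : ∑ i, Real.negMulLog (r i) - Real.negMulLog (1 - T)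
      ≤ ∑ i, Real.negMulLog (q i) := by
    rcases hT0.eq_or_lt with h0 | h0
    · have : ∀ i, b i = 0 := by
        have := (Finset.sum_eq_zero_iff_of_nonneg (fun i _ => hb0 i)).1 (hTb.trans h0.symm)
        exact fun i => this i (Finset.mem_univ i)
      rw [← h0]
      simp only [sub_zero, Real.negMulLog_one]
      refine Finset.sum_le_sum fun i _ => le_of_eq ?_
      rw [show q i = r i by have := this i; simp only [hb] at this; linarith]
    have hbT : ∀ i, 0 ≤ T * Real.negMulLog (b i / T) := fun i =>
      mul_nonneg hT0 (Real.negMulLog_nonneg (div_nonneg (hb0 i) hT0)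
        (div_le_one_of_le₀ (hTb ▸ Finset.single_le_sum (fun j _ => hb0 j) (Finset.mem_univ i)) hT0))
    -- The mixture below has weights `1 - T` and `T` and divides by both, so the extreme values of
    -- `T` are treated apart.
    rcases hT1.eq_or_lt with h1 | h1
    · have : ∀ i, r i = 0 := by
        have := (Finset.sum_eq_zero_iff_of_nonneg (fun i _ => hr0 i)).1
          (hTr.trans (by rw [h1, sub_self]))
        exact fun i => this i (Finset.mem_univ i)
      simp only [h1, this, sub_self, Real.negMulLog_zero, Finset.sum_const_zero]
      refine Finset.sum_nonneg fun i _ => Real.negMulLog_nonneg (hq i) ?_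
      exact hqs ▸ Finset.single_le_sum (fun j _ => hq j) (Finset.mem_univ i)
    have h1' : 0 < 1 - T := by linarith
    have key : ∀ i, (1 - T) * Real.negMulLog (r i / (1 - T)) ≤ Real.negMulLog (q i) := by
      intro i
      have h := Real.concaveOn_negMulLog.2 (x := r i / (1 - T)) (y := b i / T)
        (div_nonneg (hr0 i) h1'.le) (div_nonneg (hb0 i) hT0) h1'.le hT0 (by ring)
      simp only [smul_eq_mul] at h
      rw [mul_div_cancel₀ _ h1'.ne', mul_div_cancel₀ _ h0.ne'] at h
      have hq' : r i + b i = q i := by simp [hb]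
      rw [hq'] at h
      linarith [hbT i]
    refine le_trans (le_of_eq ?_) (Finset.sum_le_sum fun i _ => key i)
    have : ∀ i, (1 - T) * Real.negMulLog (r i / (1 - T))
        = Real.negMulLog (r i) + r i * Real.log (1 - T) := by
      intro i
      rw [div_eq_mul_inv, Real.negMulLog_mul]
      simp only [Real.negMulLog, Real.log_inv]
      field_simp
    simp only [this, Finset.sum_add_distrib, ← Finset.sum_mul, hTr]
    simp only [Real.negMulLog]
    ring
  rw [Real.binEntropy_eq_negMulLog_add_negMulLog_one_sub]
  linarith

/-- Bernoulli's inequality for `(x / y) ^ n`, together with `y ^ n ≤ y`. The positive part is kept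
because for two probability vectors it sums to half of their ℓ¹ distance, which saves a factor two.
-/
lemma rpow_sub_rpow_le {n x y : ℝ} (hn : 1 ≤ n) (hx : 0 ≤ x) (hy : 0 ≤ y) (hy1 : y ≤ 1) :
    y ^ n - x ^ n ≤ n * max (y - x) 0 := by
  rcases le_total y x with h | h
  · have := Real.rpow_le_rpow hy h (by linarith : 0 ≤ n)
    have : 0 ≤ n * max (y - x) 0 := mul_nonneg (by linarith) (le_max_right _ _)
    linarith
  rcases hy.eq_or_lt with rfl | hy'
  · obtain rfl : x = 0 := le_antisymm h hx
    simp
  rw [max_eq_left (by linarith)]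
  have hb := one_add_mul_self_le_rpow_one_add (s := x / y - 1) (by
    have : 0 ≤ x / y := by positivity
    linarith) hn
  rw [add_sub_cancel, Real.div_rpow hx hy] at hb
  have hyn : 0 < y ^ n := Real.rpow_pos_of_pos hy' n
  rw [le_div_iff₀ hyn] at hb
  have h1 : y ^ n ≤ y := by
    simpa using Real.rpow_le_rpow_of_exponent_ge hy' hy1 hn
  have h2 : n * (1 - x / y) * y ^ n ≤ n * (1 - x / y) * y :=
    mul_le_mul_of_nonneg_left h1 (mul_nonneg (by linarith)
      (sub_nonneg.2 (div_le_one_of_le₀ h hy)))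
  have h3 : n * (1 - x / y) * y = n * (y - x) := by field_simp
  nlinarith

lemma sum_rpow_sub_le {n : ℝ} (hn : 1 ≤ n) (p q : X → ℝ) (hp : ∀ i, 0 ≤ p i)
    (hq : ∀ i, 0 ≤ q i) (hps : ∑ i, p i = 1) (hqs : ∑ i, q i = 1) :
    ∑ i, q i ^ n - ∑ i, p i ^ n ≤ n * ((∑ i, |p i - q i|) / 2) := by
  have h1 : ∑ i, q i ^ n - ∑ i, p i ^ n ≤ ∑ i, n * max (q i - p i) 0 := by
    rw [← Finset.sum_sub_distrib]
    refine Finset.sum_le_sum fun i _ => rpow_sub_rpow_le hn (hp i) (hq i) ?_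
    exact hqs ▸ Finset.single_le_sum (fun j _ => hq j) (Finset.mem_univ i)
  refine h1.trans (le_of_eq ?_)
  rw [← Finset.mul_sum]
  congr 1
  have : ∀ i, max (q i - p i) 0 = |p i - q i| / 2 + (q i - p i) / 2 := by
    intro i
    rcases le_total (q i) (p i) with h | h
    · rw [max_eq_right (by linarith), abs_of_nonneg (by linarith)]; ring
    · rw [max_eq_left (by linarith), abs_of_nonpos (by linarith)]; ring
  simp only [this, Finset.sum_add_distrib, ← Finset.sum_div, Finset.sum_sub_distrib, hps, hqs]
  simp

lemma card_rpow_le_sum_rpow [Nonempty X] {n : ℝ} (hn : 1 ≤ n) (p : X → ℝ) (hp : ∀ i, 0 ≤ p i)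
    (hps : ∑ i, p i = 1) : ((Fintype.card X : ℝ) ^ (n - 1))⁻¹ ≤ ∑ i, p i ^ n := by
  have hD : (0 : ℝ) < Fintype.card X := by exact_mod_cast Fintype.card_pos
  have h := Real.rpow_sum_le_const_mul_sum_rpow_of_nonneg Finset.univ hn (fun i _ => hp i)
  rw [hps, Real.one_rpow, Finset.card_univ] at h
  rw [inv_le_iff_one_le_mul₀ (by positivity)]
  linarith

end Classical

open scoped ComplexOrder

/-! ## Spectral sums of Gram matrices -/

section Spectral

variable {X Y : Type*} [Fintype X] [Fintype Y]

lemma mul_conjTranspose_apply_self {Z : Type*} (M : Matrix Z Y ℂ) (i : Z) :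
    (M * Mᴴ) i i = ((∑ j, ‖M i j‖ ^ 2 : ℝ) : ℂ) := by
  rw [mul_apply]
  push_cast
  exact Finset.sum_congr rfl fun j _ => RCLike.mul_conj _

lemma trace_mul_conjTranspose_eq (M N : Matrix X Y ℂ) :
    (M * Nᴴ).trace = ∑ i, ∑ j, M i j * star (N i j) := by
  simp [trace, mul_apply]

lemma trace_mul_conjTranspose_self (M : Matrix X Y ℂ) :
    (M * Mᴴ).trace = ((∑ i, ∑ j, ‖M i j‖ ^ 2 : ℝ) : ℂ) := by
  rw [trace_mul_conjTranspose_eq]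
  push_cast
  refine Finset.sum_congr rfl fun i _ => Finset.sum_congr rfl fun j _ => ?_
  exact RCLike.mul_conj _

lemma norm_trace_mul_conjTranspose_comm (M N : Matrix X Y ℂ) :
    ‖(M * Nᴴ).trace‖ = ‖(N * Mᴴ).trace‖ := by
  rw [← norm_star, ← trace_conjTranspose, conjTranspose_mul, conjTranspose_conjTranspose]

/-- The Fuchs–van de Graaf inequality. Factor each difference of squares and apply Cauchy–Schwarz:
with `t = ∑ ‖M i j‖ ‖N i j‖ ≥ s` the two factors are `2 - 2t` and `2 + 2t`. -/
lemma sum_abs_sq_sub_sq_le {s : ℝ} (M N : Matrix X Y ℂ)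
    (hM : (M * Mᴴ).trace = 1) (hN : (N * Nᴴ).trace = 1)
    (hs : s ≤ ‖(M * Nᴴ).trace‖) (hs0 : 0 ≤ s) :
    ∑ i, |∑ j, ‖M i j‖ ^ 2 - ∑ j, ‖N i j‖ ^ 2| ≤ 2 * √(1 - s ^ 2) := by
  have hM' : ∑ i, ∑ j, ‖M i j‖ ^ 2 = 1 := by
    rw [trace_mul_conjTranspose_self] at hM; exact_mod_cast hM
  have hN' : ∑ i, ∑ j, ‖N i j‖ ^ 2 = 1 := by
    rw [trace_mul_conjTranspose_self] at hN; exact_mod_cast hN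
  set t := ∑ i, ∑ j, ‖M i j‖ * ‖N i j‖ with ht
  have hst : s ≤ t := by
    refine hs.trans ?_
    rw [trace_mul_conjTranspose_eq]
    refine (norm_sum_le _ _).trans (Finset.sum_le_sum fun i _ => (norm_sum_le _ _).trans
      (Finset.sum_le_sum fun j _ => ?_))
    rw [norm_mul, norm_star]
  have h1 : ∑ i, |∑ j, ‖M i j‖ ^ 2 - ∑ j, ‖N i j‖ ^ 2|
      ≤ ∑ p : X × Y, |‖M p.1 p.2‖ - ‖N p.1 p.2‖| * (‖M p.1 p.2‖ + ‖N p.1 p.2‖) := by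
    rw [Fintype.sum_prod_type]
    refine Finset.sum_le_sum fun i _ => ?_
    rw [← Finset.sum_sub_distrib]
    refine (Finset.abs_sum_le_sum_abs _ _).trans (Finset.sum_le_sum fun j _ => le_of_eq ?_)
    rw [sq_sub_sq, abs_mul, abs_of_nonneg (a := ‖M i j‖ + ‖N i j‖) (by positivity), mul_comm]
  have hsub : ∑ p : X × Y, |‖M p.1 p.2‖ - ‖N p.1 p.2‖| ^ 2 = 2 - 2 * t := by
    have : ∀ p : X × Y, |‖M p.1 p.2‖ - ‖N p.1 p.2‖| ^ 2
        = ‖M p.1 p.2‖ ^ 2 + ‖N p.1 p.2‖ ^ 2 - 2 * (‖M p.1 p.2‖ * ‖N p.1 p.2‖) := fun p => by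
      rw [sq_abs]; ring
    simp only [this, Fintype.sum_prod_type, Finset.sum_sub_distrib, Finset.sum_add_distrib, hM',
      hN', ← Finset.mul_sum, ← ht]
    ring
  have hadd : ∑ p : X × Y, (‖M p.1 p.2‖ + ‖N p.1 p.2‖) ^ 2 = 2 + 2 * t := by
    have : ∀ p : X × Y, (‖M p.1 p.2‖ + ‖N p.1 p.2‖) ^ 2
        = ‖M p.1 p.2‖ ^ 2 + ‖N p.1 p.2‖ ^ 2 + 2 * (‖M p.1 p.2‖ * ‖N p.1 p.2‖) := fun p => by ring
    simp only [this, Fintype.sum_prod_type, Finset.sum_add_distrib, hM',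
      hN', ← Finset.mul_sum, ← ht]
    ring
  have hcs := Finset.sum_mul_sq_le_sq_mul_sq Finset.univ
    (fun p : X × Y => |‖M p.1 p.2‖ - ‖N p.1 p.2‖|) (fun p => ‖M p.1 p.2‖ + ‖N p.1 p.2‖)
  rw [hsub, hadd] at hcs
  refine h1.trans ?_
  have h4 : (2 : ℝ) * √(1 - s ^ 2) = √(4 * (1 - s ^ 2)) := by
    rw [Real.sqrt_mul (by norm_num), show (4 : ℝ) = 2 ^ 2 by norm_num,
      Real.sqrt_sq (by norm_num)]
  rw [h4]
  refine Real.le_sqrt_of_sq_le (hcs.trans ?_)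
  nlinarith

variable [DecidableEq X]

lemma trace_cfc {A : Matrix X X ℂ} (hA : A.IsHermitian) (f : ℝ → ℝ) :
    (cfc f A).trace = ((∑ i, f (hA.eigenvalues i) : ℝ) : ℂ) := by
  rw [hA.cfc_eq, IsHermitian.cfc, Unitary.conjStarAlgAut_apply, trace_mul_comm, ← mul_assoc]
  simp [trace]

lemma sum_eigenvalues_eq_one {A : Matrix X X ℂ} (hA : A.IsHermitian) (h : A.trace = 1) :
    ∑ i, hA.eigenvalues i = 1 := by
  have ht := hA.trace_eq_sum_eigenvalues
  rw [h] at ht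
  have : ((1 : ℝ) : ℂ) = ((∑ i, hA.eigenvalues i : ℝ) : ℂ) := by push_cast; exact ht
  exact (Complex.ofReal_injective this).symm

lemma conjTranspose_mul_mul_eigenvectorUnitary {A : Matrix X X ℂ} (hA : A.IsHermitian) :
    (hA.eigenvectorUnitary : Matrix X X ℂ)ᴴ * A * (hA.eigenvectorUnitary : Matrix X X ℂ)
      = diagonal (fun i => (hA.eigenvalues i : ℂ)) := by
  have h := hA.conjStarAlgAut_star_eigenvectorUnitary
  rw [Unitary.conjStarAlgAut_apply] at h
  simpa [star_eq_conjTranspose, Function.comp_def] using h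

lemma eq_mul_diagonal_mul {A : Matrix X X ℂ} (hA : A.IsHermitian) :
    A = (hA.eigenvectorUnitary : Matrix X X ℂ) * diagonal (fun i => (hA.eigenvalues i : ℂ))
      * (hA.eigenvectorUnitary : Matrix X X ℂ)ᴴ := by
  conv_lhs => rw [hA.spectral_theorem, Unitary.conjStarAlgAut_apply]
  rfl

lemma sum_norm_sq_row {W : Matrix X X ℂ} (hW : W * Wᴴ = 1) (i : X) : ∑ j, ‖W i j‖ ^ 2 = 1 := by
  have h := congrFun (congrFun hW i) i
  rw [mul_apply, one_apply_eq] at h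
  have : ∀ j, W i j * Wᴴ j i = ((‖W i j‖ ^ 2 : ℝ) : ℂ) := fun j => by
    rw [conjTranspose_apply]; push_cast; exact RCLike.mul_conj _
  simp only [this] at h
  exact_mod_cast h

/-- The diagonal of a positive semidefinite matrix in any orthonormal basis is majorised by its
spectrum. -/
lemma sum_concaveOn_eigenvalues_le {A : Matrix X X ℂ} (hA : A.PosSemidef) {f : ℝ → ℝ}
    (hf : ConcaveOn ℝ (Set.Ici 0) f) {V : Matrix X X ℂ} (hV : Vᴴ * V = 1) :
    ∑ i, f (hA.1.eigenvalues i) ≤ ∑ i, f ((Vᴴ * A * V) i i).re := by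
  -- The numbers `‖W i j‖²` for the unitary `W = Vᴴ * U` form a doubly stochastic matrix: the rows
  -- serve as Jensen weights, and the column sums recover the spectrum.
  set U : Matrix X X ℂ := hA.1.eigenvectorUnitary.1 with hU
  have hUU : Uᴴ * U = 1 := Unitary.coe_star_mul_self hA.1.eigenvectorUnitary
  have hUU' : U * Uᴴ = 1 := Unitary.coe_mul_star_self hA.1.eigenvectorUnitary
  have hV' : V * Vᴴ = 1 := mul_eq_one_comm.1 hV
  set W := Vᴴ * U with hWdef
  have hW : W * Wᴴ = 1 := by
    rw [hWdef, conjTranspose_mul, conjTranspose_conjTranspose, mul_assoc, ← mul_assoc U, hUU',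
      one_mul, hV]
  have hW' : Wᴴ * Wᴴᴴ = 1 := by
    rw [conjTranspose_conjTranspose]; exact mul_eq_one_comm.1 hW
  have hdiag : ∀ i, ((Vᴴ * A * V) i i).re = ∑ j, ‖W i j‖ ^ 2 * hA.1.eigenvalues j := by
    intro i
    have hA' : Vᴴ * A * V = W * diagonal (fun i => (hA.1.eigenvalues i : ℂ)) * Wᴴ := by
      conv_lhs => rw [eq_mul_diagonal_mul hA.1]
      rw [hWdef, conjTranspose_mul, conjTranspose_conjTranspose]
      simp only [mul_assoc, hU]
    rw [hA', mul_apply, Complex.re_sum]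
    refine Finset.sum_congr rfl fun j _ => ?_
    rw [mul_diagonal, conjTranspose_apply, mul_right_comm]
    have : W i j * star (W i j) = ((‖W i j‖ ^ 2 : ℝ) : ℂ) := by
      push_cast; exact RCLike.mul_conj _
    rw [this, ← Complex.ofReal_mul, Complex.ofReal_re]
  have hstep : ∀ i, ∑ j, ‖W i j‖ ^ 2 * f (hA.1.eigenvalues j) ≤ f ((Vᴴ * A * V) i i).re := by
    intro i
    rw [hdiag]
    have := hf.le_map_sum (t := Finset.univ) (w := fun j => ‖W i j‖ ^ 2)
      (p := hA.1.eigenvalues) (fun _ _ => by positivity) (sum_norm_sq_row hW i)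
      (fun j _ => hA.eigenvalues_nonneg j)
    simpa using this
  refine le_trans (le_of_eq ?_) (Finset.sum_le_sum fun i _ => hstep i)
  rw [Finset.sum_comm]
  refine Finset.sum_congr rfl fun j _ => ?_
  rw [← Finset.sum_mul]
  have := sum_norm_sq_row hW' j
  simp only [conjTranspose_apply, norm_star] at this
  rw [this, one_mul]

/-- Measuring `M Mᴴ` in an eigenbasis of `N Nᴴ` gives distributions `p` and `q` whose distance is
controlled by the overlap of the purifications `M` and `N`. -/
lemma exists_pinching {s : ℝ} (M N : Matrix X Y ℂ) (hM : (M * Mᴴ).trace = 1)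
    (hN : (N * Nᴴ).trace = 1) (hs : s ≤ ‖(M * Nᴴ).trace‖) (hs0 : 0 ≤ s) :
    ∃ p q : X → ℝ, (∀ i, 0 ≤ p i) ∧ (∀ i, 0 ≤ q i) ∧ ∑ i, p i = 1 ∧ ∑ i, q i = 1 ∧
      ∑ i, |p i - q i| ≤ 2 * √(1 - s ^ 2) ∧
      (∀ f : ℝ → ℝ, (cfc f (N * Nᴴ)).trace.re = ∑ i, f (q i)) ∧
      ∀ f : ℝ → ℝ, ConcaveOn ℝ (Set.Ici 0) f → (cfc f (M * Mᴴ)).trace.re ≤ ∑ i, f (p i) := by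
  have hNh := isHermitian_mul_conjTranspose_self N
  have hMp := posSemidef_self_mul_conjTranspose M
  set V : Matrix X X ℂ := hNh.eigenvectorUnitary.1 with hV
  have hVV : Vᴴ * V = 1 := Unitary.coe_star_mul_self hNh.eigenvectorUnitary
  have hVV' : V * Vᴴ = 1 := mul_eq_one_comm.1 hVV
  have hconj : ∀ K L : Matrix X Y ℂ, (Vᴴ * K) * (Vᴴ * L)ᴴ = Vᴴ * (K * Lᴴ) * V := by
    intro K L
    rw [conjTranspose_mul, conjTranspose_conjTranspose]
    simp only [Matrix.mul_assoc]
  have htr : ∀ K L : Matrix X Y ℂ, ((Vᴴ * K) * (Vᴴ * L)ᴴ).trace = (K * Lᴴ).trace := by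
    intro K L
    rw [hconj, trace_mul_comm, ← Matrix.mul_assoc, hVV', Matrix.one_mul]
  have hq : ∀ i, ∑ j, ‖(Vᴴ * N) i j‖ ^ 2 = hNh.eigenvalues i := by
    intro i
    have h1 := mul_conjTranspose_apply_self (Vᴴ * N) i
    rw [hconj, conjTranspose_mul_mul_eigenvectorUnitary hNh, diagonal_apply_eq] at h1
    exact_mod_cast h1.symm
  refine ⟨fun i => ∑ j, ‖(Vᴴ * M) i j‖ ^ 2, fun i => ∑ j, ‖(Vᴴ * N) i j‖ ^ 2,
    fun i => by positivity, fun i => by positivity, ?_, ?_, ?_, ?_, ?_⟩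
  · have := trace_mul_conjTranspose_self (Vᴴ * M)
    rw [htr, hM] at this
    exact_mod_cast this.symm
  · have := trace_mul_conjTranspose_self (Vᴴ * N)
    rw [htr, hN] at this
    exact_mod_cast this.symm
  · exact sum_abs_sq_sub_sq_le _ _ (by rw [htr, hM]) (by rw [htr, hN]) (by rwa [htr]) hs0
  · intro f
    rw [trace_cfc hNh, Complex.ofReal_re]
    simp only [hq]
  · intro f hf
    rw [trace_cfc hMp.1, Complex.ofReal_re]
    refine (sum_concaveOn_eigenvalues_le hMp hf hVV).trans (le_of_eq ?_)
    refine Finset.sum_congr rfl fun i _ => ?_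
    rw [← hconj, mul_conjTranspose_apply_self, Complex.ofReal_re]

/-- The characteristic polynomials agree up to powers of the variable, so the spectra differ only by
zeros, which `f 0 = 0` makes invisible. -/
lemma trace_cfc_mul_conjTranspose_comm [DecidableEq Y] (M : Matrix X Y ℂ) {f : ℝ → ℝ} (hf : f 0 = 0) :
    (cfc f (M * Mᴴ)).trace = (cfc f (Mᴴ * M)).trace := by
  have h1 := isHermitian_mul_conjTranspose_self M
  have h2 := isHermitian_conjTranspose_mul_self M
  have h := congrArg Polynomial.roots (charpoly_mul_comm' M Mᴴ)
  have hX : ∀ k : ℕ, (Polynomial.X ^ k : Polynomial ℂ) ≠ 0 := fun k =>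
    pow_ne_zero _ Polynomial.X_ne_zero
  rw [Polynomial.roots_mul (mul_ne_zero (hX _) (charpoly_monic _).ne_zero),
    Polynomial.roots_mul (mul_ne_zero (hX _) (charpoly_monic _).ne_zero),
    Polynomial.roots_X_pow, Polynomial.roots_X_pow, h1.roots_charpoly_eq_eigenvalues,
    h2.roots_charpoly_eq_eigenvalues] at h
  have h' := congrArg (fun s : Multiset ℂ => (s.map fun z => f z.re).sum) h
  simp only [Multiset.map_add, Multiset.sum_add, Multiset.map_nsmul, Multiset.sum_nsmul,
    Multiset.map_singleton, Multiset.sum_singleton, Complex.zero_re, hf, smul_zero, zero_add,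
    Multiset.map_map, Function.comp_def] at h'
  rw [trace_cfc h1, trace_cfc h2]
  exact congrArg _ h'

/-! ## Continuity bounds for the entropies of two purified states -/

/-- Pinching replaces the entropy of `N` by that of `q` exactly and that of `M` by the larger
entropy of `p`; hence a one-sided bound, symmetrised later by exchanging `M` and `N`. -/
lemma vonNeumannEntropy_sub_le [Nonempty X] {s : ℝ} (M N : Matrix X Y ℂ)
    (hM : (M * Mᴴ).trace = 1) (hN : (N * Nᴴ).trace = 1) (hs : s ≤ ‖(M * Nᴴ).trace‖)
    (hs0 : 0 ≤ s) :
    vonNeumannEntropy (M * Mᴴ) - vonNeumannEntropy (N * Nᴴ)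
      ≤ √(1 - s ^ 2) * Real.log (Fintype.card X) + Real.log 2 := by
  obtain ⟨p, q, hp, hq, hps, hqs, hpq, hfN, hfM⟩ := exists_pinching M N hM hN hs hs0
  have h := sum_negMulLog_sub_le p q hp hq hps hqs
  have h1 := hfM _ Real.concaveOn_negMulLog
  have h2 := hfN Real.negMulLog
  have h3 : (∑ i, |p i - q i|) / 2 * Real.log (Fintype.card X)
      ≤ √(1 - s ^ 2) * Real.log (Fintype.card X) :=
    mul_le_mul_of_nonneg_right (by linarith) (Real.log_natCast_nonneg _)
  have h4 := Real.binEntropy_le_log_two (p := (∑ i, |p i - q i|) / 2)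
  simp only [vonNeumannEntropy]
  linarith

lemma vonNeumannEntropy_eq_of_card_eq_one (hX : Fintype.card X = 1) (M : Matrix X Y ℂ)
    (hM : (M * Mᴴ).trace = 1) : vonNeumannEntropy (M * Mᴴ) = 0 := by
  obtain ⟨x, hx⟩ := Fintype.card_eq_one_iff.1 hX
  have : Unique X := ⟨⟨x⟩, hx⟩
  have h := isHermitian_mul_conjTranspose_self M
  have h1 := sum_eigenvalues_eq_one h hM
  rw [Fintype.sum_unique] at h1
  rw [vonNeumannEntropy, trace_cfc h, Complex.ofReal_re, Fintype.sum_unique, h1,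
    Real.negMulLog_one]

lemma card_rpow_le_trace_matPow [Nonempty X] {n : ℝ} (hn : 1 ≤ n) (M : Matrix X Y ℂ)
    (hM : (M * Mᴴ).trace = 1) :
    ((Fintype.card X : ℝ) ^ (n - 1))⁻¹ ≤ (matPow (M * Mᴴ) n).trace.re := by
  have hp := posSemidef_self_mul_conjTranspose M
  rw [matPow, trace_cfc hp.1, Complex.ofReal_re]
  exact card_rpow_le_sum_rpow hn _ hp.eigenvalues_nonneg (sum_eigenvalues_eq_one hp.1 hM)

/-- With `P`, `Q` the two traces of `n`-th powers, `ln Q - ln P ≤ (Q - P) / P`. Pinching controls `Q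
- P`, and `1 / P` is at most its value at the maximally mixed state, which is the source of the
dimensional factor. -/
lemma renyiEntropy_sub_le [Nonempty X] {n s : ℝ} (hn : 1 < n) (M N : Matrix X Y ℂ)
    (hM : (M * Mᴴ).trace = 1) (hN : (N * Nᴴ).trace = 1) (hs : s ≤ ‖(M * Nᴴ).trace‖)
    (hs0 : 0 ≤ s) :
    renyiEntropy n (M * Mᴴ) - renyiEntropy n (N * Nᴴ)
      ≤ n / (n - 1) * √(1 - s ^ 2) * (Fintype.card X : ℝ) ^ (n - 1) := by
  obtain ⟨p, q, hp, hq, hps, hqs, hpq, hfN, hfM⟩ := exists_pinching M N hM hN hs hs0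
  have hD : (0 : ℝ) < Fintype.card X := by exact_mod_cast Fintype.card_pos
  have hPD := card_rpow_le_trace_matPow hn.le M hM
  have hQD := card_rpow_le_trace_matPow hn.le N hN
  have hDn : 0 < (Fintype.card X : ℝ) ^ (n - 1) := by positivity
  have hneg : ConcaveOn ℝ (Set.Ici 0) fun x : ℝ => -x ^ n := (convexOn_rpow hn.le).neg
  have h1 := hfM _ hneg
  rw [cfc_neg, trace_neg, Complex.neg_re, Finset.sum_neg_distrib] at h1
  have h2 := hfN fun x => x ^ n
  have h3 := sum_rpow_sub_le hn.le p q hp hq hps hqs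
  simp only [renyiEntropy, if_neg hn.ne']
  simp only [matPow] at hPD hQD ⊢
  set P := (cfc (fun x : ℝ => x ^ n) (M * Mᴴ)).trace.re
  set Q := (cfc (fun x : ℝ => x ^ n) (N * Nᴴ)).trace.re
  have hP : 0 < P := lt_of_lt_of_le (by positivity) hPD
  have hQ : 0 < Q := lt_of_lt_of_le (by positivity) hQD
  have hn' : 0 < n - 1 := by linarith
  have hlog : Real.log Q - Real.log P ≤ Q / P - 1 := by
    rw [← Real.log_div hQ.ne' hP.ne']
    exact Real.log_le_sub_one_of_pos (by positivity)
  have hQP : Q - P ≤ n * √(1 - s ^ 2) := by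
    have := mul_le_mul_of_nonneg_left (by linarith : (∑ i, |p i - q i|) / 2 ≤ √(1 - s ^ 2))
      (by linarith : 0 ≤ n)
    linarith
  have hinv : P⁻¹ ≤ (Fintype.card X : ℝ) ^ (n - 1) := inv_le_of_inv_le₀ hDn hPD
  have hfin : Q / P - 1 ≤ n * √(1 - s ^ 2) * (Fintype.card X : ℝ) ^ (n - 1) := by
    have : Q / P - 1 = (Q - P) * P⁻¹ := by field_simp
    rw [this]
    exact (mul_le_mul_of_nonneg_right hQP (by positivity)).trans
      (mul_le_mul_of_nonneg_left hinv (by positivity))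
  have := mul_le_mul_of_nonneg_left (hlog.trans hfin) (by positivity : 0 ≤ 1 / (n - 1))
  refine le_trans (le_of_eq ?_) (this.trans (le_of_eq ?_)) <;> ring

variable [DecidableEq Y]

lemma vonNeumannEntropy_mul_conjTranspose_comm (M : Matrix X Y ℂ) :
    vonNeumannEntropy (M * Mᴴ) = vonNeumannEntropy (Mᴴ * Mᴴᴴ) := by
  rw [vonNeumannEntropy, vonNeumannEntropy, conjTranspose_conjTranspose,
    trace_cfc_mul_conjTranspose_comm M Real.negMulLog_zero]

lemma renyiEntropy_mul_conjTranspose_comm {n : ℝ} (hn : 1 < n) (M : Matrix X Y ℂ) :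
    renyiEntropy n (M * Mᴴ) = renyiEntropy n (Mᴴ * Mᴴᴴ) := by
  rw [renyiEntropy, renyiEntropy, if_neg hn.ne', if_neg hn.ne', conjTranspose_conjTranspose,
    matPow, matPow, trace_cfc_mul_conjTranspose_comm M (f := fun x => x ^ n)
      (Real.zero_rpow (by linarith))]

lemma abs_vonNeumannEntropy_sub_le [Nonempty X] [Nonempty Y] {s : ℝ} (M N : Matrix X Y ℂ)
    (hM : (M * Mᴴ).trace = 1) (hN : (N * Nᴴ).trace = 1) (hs : s ≤ ‖(M * Nᴴ).trace‖)
    (hs0 : 0 ≤ s) :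
    |vonNeumannEntropy (M * Mᴴ) - vonNeumannEntropy (N * Nᴴ)|
      ≤ √(1 - s ^ 2) * min (Real.log (Fintype.card X)) (Real.log (Fintype.card Y))
        + Real.log 2 := by
  have hM' : (Mᴴ * Mᴴᴴ).trace = 1 := by rw [conjTranspose_conjTranspose, trace_mul_comm, hM]
  have hN' : (Nᴴ * Nᴴᴴ).trace = 1 := by rw [conjTranspose_conjTranspose, trace_mul_comm, hN]
  have hs2 : s ≤ ‖(N * Mᴴ).trace‖ := by rwa [norm_trace_mul_conjTranspose_comm]
  have hs3 : s ≤ ‖(Mᴴ * Nᴴᴴ).trace‖ := by rwa [conjTranspose_conjTranspose, trace_mul_comm]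
  have hs4 : s ≤ ‖(Nᴴ * Mᴴᴴ).trace‖ := by rwa [norm_trace_mul_conjTranspose_comm]
  rw [mul_min_of_nonneg _ _ (Real.sqrt_nonneg _), ← min_add_add_right]
  refine le_min (abs_le'.2 ⟨vonNeumannEntropy_sub_le M N hM hN hs hs0, ?_⟩)
    (abs_le'.2 ⟨?_, ?_⟩)
  · rw [neg_sub]
    exact vonNeumannEntropy_sub_le N M hN hM hs2 hs0
  · rw [vonNeumannEntropy_mul_conjTranspose_comm M, vonNeumannEntropy_mul_conjTranspose_comm N]
    exact vonNeumannEntropy_sub_le Mᴴ Nᴴ hM' hN' hs3 hs0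
  · rw [neg_sub, vonNeumannEntropy_mul_conjTranspose_comm M,
      vonNeumannEntropy_mul_conjTranspose_comm N]
    exact vonNeumannEntropy_sub_le Nᴴ Mᴴ hN' hM' hs4 hs0

lemma abs_renyiEntropy_sub_le [Nonempty X] [Nonempty Y] {n s : ℝ} (hn : 1 < n)
    (M N : Matrix X Y ℂ) (hM : (M * Mᴴ).trace = 1) (hN : (N * Nᴴ).trace = 1)
    (hs : s ≤ ‖(M * Nᴴ).trace‖) (hs0 : 0 ≤ s) :
    |renyiEntropy n (M * Mᴴ) - renyiEntropy n (N * Nᴴ)|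
      ≤ n / (n - 1) * √(1 - s ^ 2)
        * min ((Fintype.card X : ℝ) ^ (n - 1)) ((Fintype.card Y : ℝ) ^ (n - 1)) := by
  have hM' : (Mᴴ * Mᴴᴴ).trace = 1 := by rw [conjTranspose_conjTranspose, trace_mul_comm, hM]
  have hN' : (Nᴴ * Nᴴᴴ).trace = 1 := by rw [conjTranspose_conjTranspose, trace_mul_comm, hN]
  have hs2 : s ≤ ‖(N * Mᴴ).trace‖ := by rwa [norm_trace_mul_conjTranspose_comm]
  have hs3 : s ≤ ‖(Mᴴ * Nᴴᴴ).trace‖ := by rwa [conjTranspose_conjTranspose, trace_mul_comm]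
  have hs4 : s ≤ ‖(Nᴴ * Mᴴᴴ).trace‖ := by rwa [norm_trace_mul_conjTranspose_comm]
  have hn' : 0 < n - 1 := by linarith
  rw [mul_min_of_nonneg _ _ (by positivity)]
  refine le_min (abs_le'.2 ⟨renyiEntropy_sub_le hn M N hM hN hs hs0, ?_⟩)
    (abs_le'.2 ⟨?_, ?_⟩)
  · rw [neg_sub]
    exact renyiEntropy_sub_le hn N M hN hM hs2 hs0
  · rw [renyiEntropy_mul_conjTranspose_comm hn M, renyiEntropy_mul_conjTranspose_comm hn N]
    exact renyiEntropy_sub_le hn Mᴴ Nᴴ hM' hN' hs3 hs0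
  · rw [neg_sub, renyiEntropy_mul_conjTranspose_comm hn M,
      renyiEntropy_mul_conjTranspose_comm hn N]
    exact renyiEntropy_sub_le hn Nᴴ Mᴴ hN' hM' hs4 hs0

end Spectral

/-! ## The canonical purifications and their overlap -/

section Overlap

lemma pos_of_card_support_le {ι : Type*} [Fintype ι] {k : ℝ} (p : ι → ℝ) (hps : ∑ i, p i = 1)
    (hk : (Fintype.card {i // p i ≠ 0} : ℝ) ≤ k) : 0 < k := by
  obtain ⟨i, hi⟩ : ∃ i, p i ≠ 0 := by
    by_contra! h
    simp [h] at hps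
  have : Nonempty {i // p i ≠ 0} := ⟨⟨i, hi⟩⟩
  exact lt_of_lt_of_le (by exact_mod_cast Fintype.card_pos) hk

/-- The power-mean inequality on the support of `p` alone, so that `k` bounds the rank (here `χC`)
and not the full dimension. -/
lemma one_le_rpow_mul_sum_rpow {ι : Type*} [Fintype ι] {k r : ℝ} (p : ι → ℝ) (hp : ∀ i, 0 ≤ p i)
    (hps : ∑ i, p i = 1) (hk : (Fintype.card {i // p i ≠ 0} : ℝ) ≤ k) (hr : 1 ≤ r) :
    1 ≤ k ^ (r - 1) * ∑ i, p i ^ r := by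
  classical
  have hsub : ∀ r : ℝ, 0 < r → ∑ i : {i // p i ≠ 0}, p i ^ r = ∑ i, p i ^ r := by
    intro r hr
    rw [← Finset.sum_subtype (Finset.univ.filter (p · ≠ 0)) (by simp) (fun i => p i ^ r),
      Finset.sum_filter_of_ne]
    · intro i _ h hi
      rw [hi, Real.zero_rpow hr.ne'] at h
      exact h rfl
  have hps' : ∑ i : {i // p i ≠ 0}, p i = 1 := by
    have := hsub 1 one_pos
    simpa [hps] using this
  have hk1 := pos_of_card_support_le p hps le_rfl
  have hne : Nonempty {i // p i ≠ 0} := Fintype.card_pos_iff.1 (by exact_mod_cast hk1)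
  have h := card_rpow_le_sum_rpow hr (fun i : {i // p i ≠ 0} => p i) (fun i => hp i) hps'
  rw [hsub _ (by linarith), inv_le_iff_one_le_mul₀ (by positivity)] at h
  have hO0 : 0 ≤ ∑ i, p i ^ r := Finset.sum_nonneg fun i _ => Real.rpow_nonneg (hp i) _
  have := mul_le_mul_of_nonneg_left (Real.rpow_le_rpow hk1.le hk (by linarith : 0 ≤ r - 1)) hO0
  linarith

lemma one_sub_overlap_le {ι : Type*} [Fintype ι] {k m : ℝ} (p : ι → ℝ) (hp : ∀ i, 0 ≤ p i)
    (hps : ∑ i, p i = 1) (hk : (Fintype.card {i // p i ≠ 0} : ℝ) ≤ k) (hm₁ : 1 ≤ m)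
    (hm₂ : m ≤ 2) :
    1 - (∑ i, p i ^ ((1 + m) / 2)) ^ 2 / ∑ i, p i ^ m ≤ (m - 1) * (k * ∑ i, p i * p i - 1) := by
  set O := ∑ i, p i ^ ((1 + m) / 2) with hO
  set Z := ∑ i, p i ^ m with hZ
  set R := ∑ i, p i * p i with hR
  have hm' : 0 ≤ m - 1 := by linarith
  have hk0 : 0 < k := pos_of_card_support_le p hps hk
  have hO1 : 1 ≤ k ^ ((m - 1) / 2) * O := by
    have h := one_le_rpow_mul_sum_rpow (r := (1 + m) / 2) p hp hps hk (by linarith)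
    rwa [show (1 + m) / 2 - 1 = (m - 1) / 2 by ring] at h
  obtain ⟨i₀, hi₀⟩ : ∃ i, p i ≠ 0 := by
    by_contra! h
    simp [h] at hps
  have hO2 : 1 ≤ k ^ (m - 1) * O ^ 2 := by
    have h := mul_le_mul hO1 hO1 zero_le_one (by linarith)
    have hkk : k ^ (m - 1) = k ^ ((m - 1) / 2) * k ^ ((m - 1) / 2) := by
      rw [← Real.rpow_add hk0]; ring_nf
    rw [hkk]
    linarith
  have hR0 : 0 < R := by
    exact Finset.sum_pos' (fun j _ => mul_self_nonneg _)
      ⟨i₀, Finset.mem_univ _, mul_self_pos.2 hi₀⟩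
  have hZ0 : 0 < Z := by
    exact Finset.sum_pos' (fun j _ => Real.rpow_nonneg (hp j) _)
      ⟨i₀, Finset.mem_univ _, Real.rpow_pos_of_pos ((hp i₀).lt_of_ne' hi₀) _⟩
  -- Jensen for the concave function `x ^ (m - 1)` with weights `p`; this is where `m ≤ 2` is
  -- needed, as also for Bernoulli below.
  have hZR : Z ≤ R ^ (m - 1) := by
    have h := (Real.concaveOn_rpow hm' (by linarith : m - 1 ≤ 1)).le_map_sum
      (t := Finset.univ) (w := p) (p := p) (fun i _ => hp i) hps (fun i _ => hp i)
    simp only [smul_eq_mul] at h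
    refine le_trans (le_of_eq (Finset.sum_congr rfl fun i _ => ?_)) h
    rcases (hp i).eq_or_lt with h0 | h0
    · rw [← h0, Real.zero_rpow (by linarith), zero_mul]
    · rw [Real.rpow_sub_one h0.ne']; field_simp
  have hbern : (k * R) ^ (m - 1) ≤ 1 + (m - 1) * (k * R - 1) := by
    have := rpow_one_add_le_one_add_mul_self (s := k * R - 1)
      (by have := mul_pos hk0 hR0; linarith) hm' (by linarith : m - 1 ≤ 1)
    rwa [add_sub_cancel] at this
  set y := (k * R) ^ (m - 1) with hy
  have hy0 : 0 < y := by positivity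
  have hOZ : 1 ≤ y * (O ^ 2 / Z) := by
    rw [hy, Real.mul_rpow hk0.le hR0.le, mul_div_assoc', le_div_iff₀ hZ0]
    have : R ^ (m - 1) * 1 ≤ R ^ (m - 1) * (k ^ (m - 1) * O ^ 2) :=
      mul_le_mul_of_nonneg_left hO2 (by positivity)
    linarith
  have hF0 : 0 ≤ O ^ 2 / Z := by positivity
  -- From `y * F ≥ 1` with both factors nonnegative, `y + F ≥ 2`, that is `1 - F ≤ y - 1`.
  nlinarith [sq_nonneg (y - 1), sq_nonneg (O ^ 2 / Z - 1)]

variable {A B C : Type*} [Fintype A] [Fintype B] [Fintype C]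

omit [Fintype A] in
lemma partialTrace_ketBra (v : A × B → ℂ) :
    partialTrace (ketBra v) = (of fun i k => v (i, k)) * (of fun i k => v (i, k))ᴴ := by
  ext i j
  simp [partialTrace, ketBra, vecMulVec, mul_apply]

/-- The coefficient matrix of a tripartite state vector, cut between `A ⊗ B` and `C`. -/
def stateMatrix (ψ : A × B × C → ℂ) : Matrix (A × B) C ℂ :=
  of fun i k => ψ (i.1, i.2, k)

omit [Fintype A] [Fintype B] in
lemma rhoAB_eq (ψ : A × B × C → ℂ) : rhoAB ψ = stateMatrix ψ * (stateMatrix ψ)ᴴ :=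
  partialTrace_ketBra _

lemma posSemidef_rhoAB (ψ : A × B × C → ℂ) : (rhoAB ψ).PosSemidef :=
  rhoAB_eq ψ ▸ posSemidef_self_mul_conjTranspose _

lemma trace_rhoAB (ψ : A × B × C → ℂ) (hψ : ∑ x, ‖ψ x‖ ^ 2 = 1) : (rhoAB ψ).trace = 1 := by
  rw [rhoAB_eq, trace_mul_conjTranspose_self, ← Complex.ofReal_one, ← hψ]
  simp [Fintype.sum_prod_type, stateMatrix]

variable [DecidableEq A] [DecidableEq B]

lemma card_eigenvalues_rhoAB_ne_zero_le (ψ : A × B × C → ℂ) :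
    Fintype.card {i // (posSemidef_rhoAB ψ).1.eigenvalues i ≠ 0} ≤ Fintype.card C := by
  rw [← (posSemidef_rhoAB ψ).1.rank_eq_card_non_zero_eigs, rhoAB_eq]
  exact (rank_mul_le_left _ _).trans (rank_le_card_width _)

/-- The coefficient matrix, cut between `A ⊗ A⋆` and `B ⊗ B⋆`, of the normalised vector
`|ρ ^ (m/2)⟩`. -/
noncomputable def purification (m : ℝ) (ρ : Matrix (A × B) (A × B) ℂ) :
    Matrix (A × A) (B × B) ℂ :=
  (((√(matPow ρ m).trace.re)⁻¹ : ℝ) : ℂ) • of fun i k => opVec (matPow ρ (m / 2)) (i, k)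

lemma matPow_trace {X : Type*} [Fintype X] [DecidableEq X] {ρ : Matrix X X ℂ}
    (hρ : ρ.PosSemidef) (m : ℝ) :
    (matPow ρ m).trace = ((∑ i, hρ.1.eigenvalues i ^ m : ℝ) : ℂ) :=
  trace_cfc hρ.1 _

lemma trace_matPow_pos {X : Type*} [Fintype X] [DecidableEq X] {ρ : Matrix X X ℂ}
    (hρ : ρ.PosSemidef) (h : ρ.trace = 1) (m : ℝ) : 0 < (matPow ρ m).trace.re := by
  rw [matPow_trace hρ, Complex.ofReal_re]
  have hs := sum_eigenvalues_eq_one hρ.1 h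
  obtain ⟨i, hi⟩ : ∃ i, hρ.1.eigenvalues i ≠ 0 := by
    by_contra! hc
    simp [hc] at hs
  exact Finset.sum_pos' (fun j _ => Real.rpow_nonneg (hρ.eigenvalues_nonneg j) _)
    ⟨i, Finset.mem_univ _, Real.rpow_pos_of_pos ((hρ.eigenvalues_nonneg i).lt_of_ne' hi) _⟩

lemma rhoAAstar_eq {ρ : Matrix (A × B) (A × B) ℂ} (hρ : ρ.PosSemidef) (h : ρ.trace = 1) (m : ℝ) :
    rhoAAstar m ρ = purification m ρ * (purification m ρ)ᴴ := by
  have hpos := trace_matPow_pos hρ h m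
  have hre : (matPow ρ m).trace = (((matPow ρ m).trace.re : ℝ) : ℂ) := by
    rw [matPow_trace hρ, Complex.ofReal_re]
  rw [rhoAAstar, partialTrace_ketBra, purification, conjTranspose_smul, Matrix.smul_mul, Matrix.mul_smul,
    smul_smul, hre, Complex.ofReal_re]
  congr 1
  rw [RCLike.star_def, Complex.conj_ofReal, ← Complex.ofReal_mul, ← mul_inv,
    Real.mul_self_sqrt hpos.le, Complex.ofReal_inv]

omit [DecidableEq A] [DecidableEq B] in
lemma trace_opVec_mul (P Q : Matrix (A × B) (A × B) ℂ) :
    ((of fun i k => opVec P (i, k)) * (of fun i k => opVec Q (i, k))ᴴ).trace = (P * Qᴴ).trace := by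
  simp only [trace_mul_conjTranspose_eq, of_apply, opVec, Fintype.sum_prod_type]
  refine Finset.sum_congr rfl fun a _ => ?_
  rw [Finset.sum_comm]

/-- Positive exponents make `x ^ s` continuous at the zero eigenvalues of `ρ`, which the functional
calculus requires. -/
lemma trace_matPow_mul {ρ : Matrix (A × B) (A × B) ℂ} (hρ : ρ.PosSemidef) {s t : ℝ} (hs : 0 < s)
    (ht : 0 < t) :
    (matPow ρ s * (matPow ρ t)ᴴ).trace = ((∑ i, hρ.1.eigenvalues i ^ (s + t) : ℝ) : ℂ) := by
  have hsa : (matPow ρ t)ᴴ = matPow ρ t := (cfc_predicate (fun x : ℝ => x ^ t) ρ : IsSelfAdjoint _)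
  rw [hsa, matPow, matPow, ← cfc_mul (fun x : ℝ => x ^ s) (fun x : ℝ => x ^ t) ρ
    (Real.continuous_rpow_const hs.le).continuousOn (Real.continuous_rpow_const ht.le).continuousOn,
    trace_cfc hρ.1]
  refine congrArg _ (Finset.sum_congr rfl fun i _ => ?_)
  rw [Real.rpow_add_of_nonneg (hρ.eigenvalues_nonneg i) hs.le ht.le]

lemma trace_purification_mul {ρ : Matrix (A × B) (A × B) ℂ} (hρ : ρ.PosSemidef) {s t : ℝ}
    (hs : 0 < s) (ht : 0 < t) :
    (purification s ρ * (purification t ρ)ᴴ).trace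
      = (((√(∑ i, hρ.1.eigenvalues i ^ s))⁻¹ * (√(∑ i, hρ.1.eigenvalues i ^ t))⁻¹
        * ∑ i, hρ.1.eigenvalues i ^ ((s + t) / 2) : ℝ) : ℂ) := by
  have hstar : ∀ x : ℝ, star (x : ℂ) = x := Complex.conj_ofReal
  rw [purification, purification, conjTranspose_smul, Matrix.smul_mul, Matrix.mul_smul, smul_smul, trace_smul,
    trace_opVec_mul, trace_matPow_mul hρ (half_pos hs) (half_pos ht), hstar, matPow_trace hρ, matPow_trace hρ, Complex.ofReal_re, Complex.ofReal_re,
    smul_eq_mul, ← Complex.ofReal_mul, ← Complex.ofReal_mul, add_div]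

lemma trace_purification_self {ρ : Matrix (A × B) (A × B) ℂ} (hρ : ρ.PosSemidef)
    (h : ρ.trace = 1) {s : ℝ} (hs : 0 < s) :
    (purification s ρ * (purification s ρ)ᴴ).trace = 1 := by
  have hpos := trace_matPow_pos hρ h s
  rw [matPow_trace hρ, Complex.ofReal_re] at hpos
  rw [trace_purification_mul hρ hs hs, add_self_div_two, ← mul_inv, Real.mul_self_sqrt hpos.le,
    inv_mul_cancel₀ hpos.ne', Complex.ofReal_one]

lemma trace_sq_eq {X : Type*} [Fintype X] [DecidableEq X] {ρ : Matrix X X ℂ}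
    (hρ : ρ.IsHermitian) :
    (ρ * ρ).trace = ((∑ i, hρ.eigenvalues i * hρ.eigenvalues i : ℝ) : ℂ) := by
  have h := cfc_mul (fun x : ℝ => x) (fun x : ℝ => x) ρ continuousOn_id continuousOn_id
  rw [cfc_id' ℝ ρ hρ.isSelfAdjoint] at h
  rw [← h, trace_cfc hρ]

lemma exists_overlap (ψ : A × B × C → ℂ) (hψ : ∑ x, ‖ψ x‖ ^ 2 = 1) {m : ℝ} (hm₁ : 1 ≤ m)
    (hm₂ : m ≤ 2) :
    ∃ s : ℝ, 0 ≤ s ∧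
      s ≤ ‖(purification 1 (rhoAB ψ) * (purification m (rhoAB ψ))ᴴ).trace‖ ∧
      1 - s ^ 2 ≤ (m - 1) * (Fintype.card C * (rhoAB ψ * rhoAB ψ).trace.re - 1) := by
  have hρ := posSemidef_rhoAB ψ
  have htr := trace_rhoAB ψ hψ
  have hs := sum_eigenvalues_eq_one hρ.1 htr
  have hZ : 0 ≤ ∑ i, hρ.1.eigenvalues i ^ m :=
    Finset.sum_nonneg fun i _ => Real.rpow_nonneg (hρ.eigenvalues_nonneg i) _
  -- This is the overlap itself: the normalisation of the purification with exponent one is `Tr ρ =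
  -- 1`.
  refine ⟨(√(∑ i, hρ.1.eigenvalues i ^ m))⁻¹ * ∑ i, hρ.1.eigenvalues i ^ ((1 + m) / 2),
    ?_, ?_, ?_⟩
  · exact mul_nonneg (by positivity)
      (Finset.sum_nonneg fun i _ => Real.rpow_nonneg (hρ.eigenvalues_nonneg i) _)
  · rw [trace_purification_mul hρ one_pos (by linarith), Complex.norm_real]
    refine le_trans (le_of_eq ?_) (le_abs_self _)
    simp [hs]
  · have h := one_sub_overlap_le (k := Fintype.card C) hρ.1.eigenvalues hρ.eigenvalues_nonneg hs
      (by exact_mod_cast card_eigenvalues_rhoAB_ne_zero_le ψ) hm₁ hm₂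
    rw [trace_sq_eq hρ.1, Complex.ofReal_re]
    refine le_trans (le_of_eq ?_) h
    rw [mul_pow, inv_pow, Real.sq_sqrt hZ]
    ring

/-- The bound for the square of the distance of the two canonical purifications. -/
noncomputable def purityDefect (m : ℝ) (ψ : A × B × C → ℂ) : ℝ :=
  (m - 1) * (Fintype.card C * (rhoAB ψ * rhoAB ψ).trace.re - 1)

lemma purityDefect_nonneg (ψ : A × B × C → ℂ) (hψ : ∑ x, ‖ψ x‖ ^ 2 = 1) {m : ℝ}
    (hm : 1 ≤ m) : 0 ≤ purityDefect m ψ := by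
  have hρ := posSemidef_rhoAB ψ
  have h := one_le_rpow_mul_sum_rpow (k := Fintype.card C) (r := 2) hρ.1.eigenvalues
    hρ.eigenvalues_nonneg (sum_eigenvalues_eq_one hρ.1 (trace_rhoAB ψ hψ))
    (by exact_mod_cast card_eigenvalues_rhoAB_ne_zero_le ψ) one_le_two
  rw [show (2 : ℝ) - 1 = 1 by norm_num, Real.rpow_one] at h
  simp only [Real.rpow_two, sq] at h
  rw [purityDefect, trace_sq_eq hρ.1, Complex.ofReal_re]
  exact mul_nonneg (by linarith) (by linarith)

lemma abs_reflectedEntropy_sub_le [Nonempty A] [Nonempty B] (ψ : A × B × C → ℂ)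
    (hψ : ∑ x, ‖ψ x‖ ^ 2 = 1) {m n : ℝ} (hm₁ : 1 ≤ m) (hm₂ : m ≤ 2) (hn : 1 < n) :
    |reflectedEntropy 1 n ψ - reflectedEntropy m n ψ| ≤ n / (n - 1) * √(purityDefect m ψ)
      * min ((Fintype.card A : ℝ) ^ (2 * (n - 1))) ((Fintype.card B : ℝ) ^ (2 * (n - 1))) := by
  obtain ⟨s, hs0, hs, hs1⟩ := exists_overlap ψ hψ hm₁ hm₂
  have hρ := posSemidef_rhoAB ψ
  have htr := trace_rhoAB ψ hψ
  have h := abs_renyiEntropy_sub_le hn _ _ (trace_purification_self hρ htr one_pos)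
    (trace_purification_self hρ htr (by linarith : 0 < m)) hs hs0
  rw [← rhoAAstar_eq hρ htr, ← rhoAAstar_eq hρ htr] at h
  have hcard : ∀ D : ℕ, ((D * D : ℕ) : ℝ) ^ (n - 1) = (D : ℝ) ^ (2 * (n - 1)) := fun D => by
    rw [Real.rpow_mul (Nat.cast_nonneg _), Nat.cast_mul, Real.rpow_two, sq]
  rw [Fintype.card_prod, Fintype.card_prod, hcard, hcard] at h
  refine h.trans ?_
  have hn' : 0 < n - 1 := by linarith
  gcongr
  exact hs1

lemma abs_reflectedEntropy_one_sub_le [Nonempty A] [Nonempty B] (ψ : A × B × C → ℂ)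
    (hψ : ∑ x, ‖ψ x‖ ^ 2 = 1) {m : ℝ} (hm₁ : 1 ≤ m) (hm₂ : m ≤ 2) :
    |reflectedEntropy 1 1 ψ - reflectedEntropy m 1 ψ| ≤ 2 * √(purityDefect m ψ)
      * min (Real.log (Fintype.card A)) (Real.log (Fintype.card B)) + Real.log 2 := by
  obtain ⟨s, hs0, hs, hs1⟩ := exists_overlap ψ hψ hm₁ hm₂
  have hρ := posSemidef_rhoAB ψ
  have htr := trace_rhoAB ψ hψ
  have h := abs_vonNeumannEntropy_sub_le _ _ (trace_purification_self hρ htr one_pos)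
    (trace_purification_self hρ htr (by linarith : 0 < m)) hs hs0
  rw [← rhoAAstar_eq hρ htr, ← rhoAAstar_eq hρ htr] at h
  -- The local dimension is that of `A ⊗ A⋆`, and `ln χ² = 2 ln χ` produces the constant two.
  have hcard : ∀ D : ℕ, Real.log ((D * D : ℕ) : ℝ) = 2 * Real.log D := fun D => by
    rw [← sq, Nat.cast_pow, Real.log_pow, Nat.cast_ofNat]
  rw [Fintype.card_prod, Fintype.card_prod, hcard, hcard, ← mul_min_of_nonneg _ _ two_pos.le,
    ← mul_assoc, mul_comm _ (2 : ℝ)] at h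
  simp only [reflectedEntropy, renyiEntropy, if_true]
  refine h.trans ?_
  have : 0 ≤ min (Real.log (Fintype.card A)) (Real.log (Fintype.card B)) :=
    le_min (Real.log_natCast_nonneg _) (Real.log_natCast_nonneg _)
  gcongr
  exact hs1

/-- Serves the strict inequality when `min {ln χA, ln χB} = 0`, where the general estimate only
gives `≤ ln 2`. -/
lemma reflectedEntropy_one_eq_zero (ψ : A × B × C → ℂ) (hψ : ∑ x, ‖ψ x‖ ^ 2 = 1) {m : ℝ}
    (hm : 0 < m) (h : Fintype.card A = 1 ∨ Fintype.card B = 1) :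
    reflectedEntropy m 1 ψ = 0 := by
  have hρ := posSemidef_rhoAB ψ
  have htr := trace_rhoAB ψ hψ
  have hp := trace_purification_self hρ htr hm
  simp only [reflectedEntropy, renyiEntropy, if_true]
  rw [rhoAAstar_eq hρ htr]
  rcases h with h | h
  · exact vonNeumannEntropy_eq_of_card_eq_one (by simp [h]) _ hp
  · rw [vonNeumannEntropy_mul_conjTranspose_comm]
    refine vonNeumannEntropy_eq_of_card_eq_one (by simp [h]) _ ?_
    rw [conjTranspose_conjTranspose, trace_mul_comm, hp]

end Overlap

/-! ## Fourth moments of a Haar-random state -/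

section Moments

variable {X : Type*} [Fintype X] [DecidableEq X]

instance : (haarUnitary X).IsMulLeftInvariant :=
  inferInstanceAs (Measure.haarMeasure _).IsMulLeftInvariant

lemma integrable_of_continuous {f : unitaryGroup X ℂ → ℝ} (hf : Continuous f) :
    Integrable f (haarUnitary X) :=
  hf.integrable_of_hasCompactSupport (HasCompactSupport.of_compactSpace f)

lemma continuous_mulVec (ψ : X → ℂ) : Continuous fun U : unitaryGroup X ℂ => U.1 *ᵥ ψ :=
  continuous_subtype_val.matrix_mulVec continuous_const

lemma integral_mulVec_left (V : unitaryGroup X ℂ) (ψ : X → ℂ) (f : (X → ℂ) → ℝ) :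
    ∫ U : unitaryGroup X ℂ, f (V.1 *ᵥ (U.1 *ᵥ ψ)) ∂haarUnitary X
      = ∫ U : unitaryGroup X ℂ, f (U.1 *ᵥ ψ) ∂haarUnitary X := by
  rw [← integral_mul_left_eq_self (fun U : unitaryGroup X ℂ => f (U.1 *ᵥ ψ)) V]
  simp [mulVec_mulVec]

lemma sum_norm_sq_mulVec (U : unitaryGroup X ℂ) (ψ : X → ℂ) :
    ∑ x, ‖(U.1 *ᵥ ψ) x‖ ^ 2 = ∑ x, ‖ψ x‖ ^ 2 := by
  have key : ∀ v : X → ℂ, ((∑ x, ‖v x‖ ^ 2 : ℝ) : ℂ) = star v ⬝ᵥ v := by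
    intro v
    push_cast
    exact Finset.sum_congr rfl fun x _ => (RCLike.conj_mul _).symm
  have hU : U.1ᴴ * U.1 = 1 := Unitary.coe_star_mul_self U
  refine Complex.ofReal_injective ?_
  rw [key, key, star_mulVec, dotProduct_mulVec, vecMul_vecMul, hU, vecMul_one]

lemma exists_unitary_row (x : X) (w : X → ℂ) (hw : ∑ i, ‖w i‖ ^ 2 = 1) :
    ∃ V : unitaryGroup X ℂ, ∀ j, V.1 x j = w j := by
  have hon : Orthonormal ℂ (({x} : Set X).domRestrict
      fun _ : X => (WithLp.toLp 2 w : EuclideanSpace ℂ X)) := by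
    refine ⟨fun _ => ?_, fun i j hij => (hij (Subsingleton.elim i j)).elim⟩
    rw [Set.domRestrict_apply, EuclideanSpace.norm_eq]
    simp [hw]
  obtain ⟨b, hb⟩ := hon.exists_orthonormalBasis_extension_of_card_eq (by simp)
  refine ⟨⟨of fun i j => b i j, ?_⟩, fun j => ?_⟩
  · rw [mem_unitaryGroup_iff]
    ext i j
    have := orthonormal_iff_ite.1 b.orthonormal j i
    rw [EuclideanSpace.inner_eq_star_dotProduct] at this
    simp only [mul_apply, star_apply, of_apply, one_apply]
    simp only [dotProduct, Pi.star_apply] at this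
    rw [this]
    simp [eq_comm]
  · simp [hb x rfl]

variable (ψ : X → ℂ)

/-- Every unit vector is a row of some unitary, so left invariance of the Haar measure identifies
its pairing with the random state with a single coordinate. -/
lemma integral_norm_pow_four_eq (x : X) (w : X → ℂ) (hw : ∑ i, ‖w i‖ ^ 2 = 1) :
    ∫ U : unitaryGroup X ℂ, ‖w ⬝ᵥ (U.1 *ᵥ ψ)‖ ^ 4 ∂haarUnitary X
      = ∫ U : unitaryGroup X ℂ, ‖(U.1 *ᵥ ψ) x‖ ^ 4 ∂haarUnitary X := by
  obtain ⟨V, hV⟩ := exists_unitary_row x w hw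
  rw [← integral_mulVec_left V ψ fun φ => ‖φ x‖ ^ 4]
  have : w = V.1 x := funext fun j => (hV j).symm
  rw [this]
  rfl

/-- Summing over the four phases cancels every mixed term other than `‖a‖² ‖b‖²`. -/
lemma norm_add_pow_four_sum (a b : ℂ) :
    ‖a + b‖ ^ 4 + ‖a - b‖ ^ 4 + ‖a + Complex.I * b‖ ^ 4 + ‖a - Complex.I * b‖ ^ 4
      = 4 * (‖a‖ ^ 4 + ‖b‖ ^ 4 + 4 * (‖a‖ ^ 2 * ‖b‖ ^ 2)) := by
  have h : ∀ z : ℂ, ‖z‖ ^ 4 = (z.re * z.re + z.im * z.im) ^ 2 := fun z => by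
    rw [show 4 = 2 * 2 from rfl, pow_mul, Complex.sq_norm, Complex.normSq_apply]
  simp only [h, Complex.sq_norm, Complex.normSq_apply, Complex.add_re, Complex.add_im,
    Complex.sub_re, Complex.sub_im, Complex.mul_re, Complex.mul_im, Complex.I_re, Complex.I_im]
  ring

lemma integral_norm_add_pow_four (x y : X) (hxy : x ≠ y) (ω : ℂ) (hω : ‖ω‖ = 1) :
    ∫ U : unitaryGroup X ℂ, ‖(U.1 *ᵥ ψ) x + ω * (U.1 *ᵥ ψ) y‖ ^ 4 ∂haarUnitary X
      = 4 * ∫ U : unitaryGroup X ℂ, ‖(U.1 *ᵥ ψ) x‖ ^ 4 ∂haarUnitary X := by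
  set c : ℂ := Complex.ofReal (√2)⁻¹ with hc
  have hcn : ‖c‖ ^ 2 = 2⁻¹ := by
    rw [hc, Complex.norm_real, Real.norm_eq_abs, sq_abs, inv_pow, Real.sq_sqrt two_pos.le]
  have hw : ∑ i, ‖(Pi.single x c + Pi.single y (c * ω) : X → ℂ) i‖ ^ 2 = 1 := by
    rw [Fintype.sum_eq_add x y hxy]
    · simp [hxy, hxy.symm, hω, hcn]; norm_num
    · rintro i ⟨h1, h2⟩
      simp [h1, h2]
  rw [← integral_norm_pow_four_eq ψ x _ hw, ← integral_const_mul]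
  refine integral_congr_ae (Filter.Eventually.of_forall fun U => ?_)
  simp only [add_dotProduct, single_dotProduct]
  rw [show c * (U.1 *ᵥ ψ) x + c * ω * (U.1 *ᵥ ψ) y
    = c * ((U.1 *ᵥ ψ) x + ω * (U.1 *ᵥ ψ) y) by ring, norm_mul, mul_pow,
    show ‖c‖ ^ 4 = (‖c‖ ^ 2) ^ 2 by ring, hcn]
  ring

lemma continuous_coord (x : X) : Continuous fun U : unitaryGroup X ℂ => (U.1 *ᵥ ψ) x :=
  (continuous_apply x).comp (continuous_mulVec ψ)

lemma integral_norm_pow_four_coord (x y : X) :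
    ∫ U : unitaryGroup X ℂ, ‖(U.1 *ᵥ ψ) y‖ ^ 4 ∂haarUnitary X
      = ∫ U : unitaryGroup X ℂ, ‖(U.1 *ᵥ ψ) x‖ ^ 4 ∂haarUnitary X := by
  rw [← integral_norm_pow_four_eq ψ x (Pi.single y 1) (by
    rw [Fintype.sum_eq_single y (fun i hi => by simp [hi])]; simp)]
  simp

/-- Integrate the four-phase identity: with `u` the fourth moment and `v` the mixed moment, `16 u =
4 (2 u + 4 v)`, hence `u = 2 v`. -/
lemma integral_norm_sq_mul_norm_sq {x y : X} (hxy : x ≠ y) :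
    2 * ∫ U : unitaryGroup X ℂ, ‖(U.1 *ᵥ ψ) x‖ ^ 2 * ‖(U.1 *ᵥ ψ) y‖ ^ 2 ∂haarUnitary X
      = ∫ U : unitaryGroup X ℂ, ‖(U.1 *ᵥ ψ) x‖ ^ 4 ∂haarUnitary X := by
  have hx := continuous_coord ψ x
  have hy := continuous_coord ψ y
  have h1 := integral_norm_add_pow_four ψ x y hxy 1 (by simp)
  have h2 := integral_norm_add_pow_four ψ x y hxy (-1) (by simp)
  have h3 := integral_norm_add_pow_four ψ x y hxy Complex.I (by simp)
  have h4 := integral_norm_add_pow_four ψ x y hxy (-Complex.I) (by simp)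
  simp only [one_mul, neg_mul, ← sub_eq_add_neg] at h1 h2 h3 h4
  have hsum : ∫ U : unitaryGroup X ℂ, (‖(U.1 *ᵥ ψ) x + (U.1 *ᵥ ψ) y‖ ^ 4
      + ‖(U.1 *ᵥ ψ) x - (U.1 *ᵥ ψ) y‖ ^ 4 + ‖(U.1 *ᵥ ψ) x + Complex.I * (U.1 *ᵥ ψ) y‖ ^ 4
      + ‖(U.1 *ᵥ ψ) x - Complex.I * (U.1 *ᵥ ψ) y‖ ^ 4) ∂haarUnitary X
      = 16 * ∫ U : unitaryGroup X ℂ, ‖(U.1 *ᵥ ψ) x‖ ^ 4 ∂haarUnitary X := by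
    rw [integral_add (integrable_of_continuous (by fun_prop))
      (integrable_of_continuous (by fun_prop)), integral_add
      (integrable_of_continuous (by fun_prop)) (integrable_of_continuous (by fun_prop)),
      integral_add (integrable_of_continuous (by fun_prop))
      (integrable_of_continuous (by fun_prop)), h1, h2, h3, h4]
    ring
  simp only [norm_add_pow_four_sum] at hsum
  rw [integral_const_mul, integral_add (integrable_of_continuous (by fun_prop))
    (integrable_of_continuous (by fun_prop)), integral_add
    (integrable_of_continuous (by fun_prop)) (integrable_of_continuous (by fun_prop)),
    integral_const_mul, integral_norm_pow_four_coord ψ x y] at hsum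
  linarith

/-- The second moments of the weights of a Haar-random unit vector in a fixed basis. -/
lemma integral_norm_sq_mul_norm_sq_eq (hψ : ∑ x, ‖ψ x‖ ^ 2 = 1) (x y : X) :
    ∫ U : unitaryGroup X ℂ, ‖(U.1 *ᵥ ψ) x‖ ^ 2 * ‖(U.1 *ᵥ ψ) y‖ ^ 2 ∂haarUnitary X
      = (if x = y then 2 else 1) / (Fintype.card X * (Fintype.card X + 1)) := by
  set u := ∫ U : unitaryGroup X ℂ, ‖(U.1 *ᵥ ψ) x‖ ^ 4 ∂haarUnitary X with hu
  have hJ : ∀ a b : X, ∫ U : unitaryGroup X ℂ, ‖(U.1 *ᵥ ψ) a‖ ^ 2 * ‖(U.1 *ᵥ ψ) b‖ ^ 2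
      ∂haarUnitary X = u / 2 + if a = b then u / 2 else 0 := by
    intro a b
    split_ifs with h
    · subst h
      rw [add_halves, hu, ← integral_norm_pow_four_coord ψ x a]
      exact integral_congr_ae (Filter.Eventually.of_forall fun U => by ring)
    · have := integral_norm_sq_mul_norm_sq ψ h
      rw [integral_norm_pow_four_coord ψ x a, ← hu] at this
      linarith
  have hcont : ∀ a b : X, Continuous fun U : unitaryGroup X ℂ =>
      ‖(U.1 *ᵥ ψ) a‖ ^ 2 * ‖(U.1 *ᵥ ψ) b‖ ^ 2 := fun a b => by
    have ha := continuous_coord ψ a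
    have hb := continuous_coord ψ b
    fun_prop
  -- Squaring the normalisation of the state fixes `u`: the double sum equals `(u / 2) * N * (N +
  -- 1)` with `N = Fintype.card X`.
  have htot : ∑ a : X, ∑ b : X, (u / 2 + if a = b then u / 2 else 0) = 1 := by
    simp only [← hJ]
    have h1 : ∀ a, ∑ b, ∫ U : unitaryGroup X ℂ, ‖(U.1 *ᵥ ψ) a‖ ^ 2 * ‖(U.1 *ᵥ ψ) b‖ ^ 2
        ∂haarUnitary X = ∫ U : unitaryGroup X ℂ,
          ∑ b, ‖(U.1 *ᵥ ψ) a‖ ^ 2 * ‖(U.1 *ᵥ ψ) b‖ ^ 2 ∂haarUnitary X := fun a =>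
      (integral_finsetSum _ fun b _ => integrable_of_continuous (hcont a b)).symm
    simp only [h1]
    rw [← integral_finsetSum _ fun a _ => integrable_of_continuous
      (continuous_finsetSum _ fun b _ => hcont a b)]
    simp only [← Finset.mul_sum, ← Finset.sum_mul, sum_norm_sq_mulVec, hψ]
    simp
  have hN : (0 : ℝ) < Fintype.card X := by
    exact_mod_cast Fintype.card_pos_iff.2 ⟨x⟩
  simp only [Finset.sum_add_distrib, Finset.sum_ite_eq, Finset.mem_univ, if_true, Finset.sum_const,
    Finset.card_univ, nsmul_eq_mul] at htot
  have hu' : u / 2 = 1 / (Fintype.card X * (Fintype.card X + 1)) := by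
    rw [eq_div_iff (by positivity)]
    linarith
  rw [hJ, hu']
  split_ifs <;> ring

/-- A moment in which some coordinate occurs exactly once vanishes. -/
lemma integral_eq_zero_of_flip (x : X) (f : (X → ℂ) → ℝ)
    (hf : ∀ φ : X → ℂ, f (Function.update φ x (-φ x)) = -f φ) :
    ∫ U : unitaryGroup X ℂ, f (U.1 *ᵥ ψ) ∂haarUnitary X = 0 := by
  have hV : diagonal (Function.update (1 : X → ℂ) x (-1)) ∈ unitaryGroup X ℂ := by
    rw [mem_unitaryGroup_iff, star_eq_conjTranspose, diagonal_conjTranspose, diagonal_mul_diagonal,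
      ← diagonal_one]
    congr 1
    ext i
    rcases eq_or_ne i x with rfl | h
    · simp
    · simp [h]
  have h := integral_mulVec_left ⟨_, hV⟩ ψ f
  have h2 : ∀ φ : X → ℂ, diagonal (Function.update (1 : X → ℂ) x (-1)) *ᵥ φ
      = Function.update φ x (-φ x) := by
    intro φ
    ext i
    rw [mulVec_diagonal]
    rcases eq_or_ne i x with rfl | h
    · simp
    · simp [h]
  simp only [h2, hf, integral_neg] at h
  linarith

end Moments

/-! ### Mean purity of `ρ_{AB}` and the averaged defect. -/

section Purity

variable {A B C : Type*} [Fintype A] [Fintype B] [Fintype C]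

lemma trace_rhoAB_mul_self_re (φ : A × B × C → ℂ) :
    (rhoAB φ * rhoAB φ).trace.re = ∑ i : A × B, ∑ j : A × B, ∑ c : C, ∑ c' : C,
      (φ (i.1, i.2, c) * star (φ (j.1, j.2, c)) * (φ (j.1, j.2, c') * star (φ (i.1, i.2, c')))).re := by
  rw [rhoAB_eq, trace, Complex.re_sum]
  refine Finset.sum_congr rfl fun i _ => ?_
  rw [diag_apply, mul_apply, Complex.re_sum]
  refine Finset.sum_congr rfl fun j _ => ?_
  rw [mul_apply, mul_apply, Finset.sum_mul_sum, Complex.re_sum]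
  refine Finset.sum_congr rfl fun c _ => ?_
  rw [Complex.re_sum]
  rfl

variable [DecidableEq A] [DecidableEq B] [DecidableEq C]

lemma continuous_stateMatrix (ψ : A × B × C → ℂ) :
    Continuous fun U : unitaryGroup (A × B × C) ℂ => stateMatrix (U.1 *ᵥ ψ) :=
  continuous_matrix fun _ _ => continuous_coord ψ _

lemma continuous_rhoAB (ψ : A × B × C → ℂ) :
    Continuous fun U : unitaryGroup (A × B × C) ℂ => rhoAB (U.1 *ᵥ ψ) := by
  simp only [rhoAB_eq]
  exact (continuous_stateMatrix ψ).matrix_mul (continuous_stateMatrix ψ).matrix_conjTranspose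

/-- If `i = j` or `c = c'` the four amplitudes pair into two weights. Otherwise the amplitude at
`(i, c)` occurs once, and flipping its sign shows that the mean is zero. -/
lemma integral_purity_term (ψ : A × B × C → ℂ) (hψ : ∑ x, ‖ψ x‖ ^ 2 = 1) (i j : A × B) (c c' : C) :
    ∫ U : unitaryGroup (A × B × C) ℂ, ((U.1 *ᵥ ψ) (i.1, i.2, c) * star ((U.1 *ᵥ ψ) (j.1, j.2, c))
        * ((U.1 *ᵥ ψ) (j.1, j.2, c') * star ((U.1 *ᵥ ψ) (i.1, i.2, c')))).re
        ∂haarUnitary (A × B × C)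
      = ((if i = j then 1 else 0) + if c = c' then 1 else 0)
        / (Fintype.card (A × B × C) * (Fintype.card (A × B × C) + 1)) := by
  have hns : ∀ a b : ℂ, (a * star a * (b * star b)).re = ‖a‖ ^ 2 * ‖b‖ ^ 2 := fun a b => by
    have h : ∀ z : ℂ, z * star z = ((‖z‖ ^ 2 : ℝ) : ℂ) := fun z => by
      push_cast; exact RCLike.mul_conj z
    rw [h, h, ← Complex.ofReal_mul, Complex.ofReal_re]
  by_cases hij : i = j
  · subst hij
    simp only [hns]
    rw [integral_norm_sq_mul_norm_sq_eq ψ hψ]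
    by_cases hc : c = c' <;> simp [hc]
    norm_num
  by_cases hc : c = c'
  · subst hc
    have hns' : ∀ a b : ℂ, (a * star b * (b * star a)).re = ‖a‖ ^ 2 * ‖b‖ ^ 2 := fun a b => by
      rw [← hns]; ring_nf
    simp only [hns']
    rw [integral_norm_sq_mul_norm_sq_eq ψ hψ, if_neg, if_neg hij]
    · simp
    · intro h
      simp only [Prod.mk.injEq] at h
      exact hij (Prod.ext h.1 h.2.1)
  · rw [if_neg hij, if_neg hc, add_zero, zero_div]
    refine integral_eq_zero_of_flip ψ (i.1, i.2, c) (fun φ => (φ (i.1, i.2, c)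
      * star (φ (j.1, j.2, c)) * (φ (j.1, j.2, c') * star (φ (i.1, i.2, c')))).re) fun φ => ?_
    have h1 : (j.1, j.2, c) ≠ (i.1, i.2, c) := fun h => by
      simp only [Prod.mk.injEq] at h
      exact hij (Prod.ext h.1.symm h.2.1.symm)
    have h2 : (j.1, j.2, c') ≠ (i.1, i.2, c) := fun h => by
      simp only [Prod.mk.injEq] at h
      exact hc h.2.2.symm
    have h3 : (i.1, i.2, c') ≠ (i.1, i.2, c) := fun h => by
      simp only [Prod.mk.injEq] at h
      exact hc h.2.2.symm
    rw [Function.update_self, Function.update_of_ne h1, Function.update_of_ne h2,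
      Function.update_of_ne h3, neg_mul, neg_mul, Complex.neg_re]

/-- The mean purity of `ρ_{AB}` for a Haar-random state. -/
lemma integral_purity (ψ : A × B × C → ℂ) (hψ : ∑ x, ‖ψ x‖ ^ 2 = 1) :
    ∫ U : unitaryGroup (A × B × C) ℂ, (rhoAB (U.1 *ᵥ ψ) * rhoAB (U.1 *ᵥ ψ)).trace.re
        ∂haarUnitary (A × B × C)
      = ((Fintype.card A * Fintype.card B : ℝ) + Fintype.card C)
        / (Fintype.card A * Fintype.card B * Fintype.card C + 1) := by
  have hcont : ∀ (i j : A × B) (c c' : C), Continuous fun U : unitaryGroup (A × B × C) ℂ =>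
      ((U.1 *ᵥ ψ) (i.1, i.2, c) * star ((U.1 *ᵥ ψ) (j.1, j.2, c))
        * ((U.1 *ᵥ ψ) (j.1, j.2, c') * star ((U.1 *ᵥ ψ) (i.1, i.2, c')))).re :=
    fun i j c c' => Complex.continuous_re.comp
      (((continuous_coord ψ _).mul (continuous_coord ψ _).star).mul
        ((continuous_coord ψ _).mul (continuous_coord ψ _).star))
  simp only [trace_rhoAB_mul_self_re]
  rw [integral_finsetSum _ fun i _ => integrable_of_continuous (continuous_finsetSum _ fun j _ =>
    continuous_finsetSum _ fun c _ => continuous_finsetSum _ fun c' _ => hcont i j c c')]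
  have hsum : ∀ i : A × B, ∫ U : unitaryGroup (A × B × C) ℂ, ∑ j : A × B, ∑ c : C, ∑ c' : C,
      ((U.1 *ᵥ ψ) (i.1, i.2, c) * star ((U.1 *ᵥ ψ) (j.1, j.2, c))
        * ((U.1 *ᵥ ψ) (j.1, j.2, c') * star ((U.1 *ᵥ ψ) (i.1, i.2, c')))).re
        ∂haarUnitary (A × B × C)
      = ∑ j : A × B, ∑ c : C, ∑ c' : C, ((if i = j then 1 else 0) + if c = c' then 1 else 0)
        / ((Fintype.card (A × B × C) : ℝ) * (Fintype.card (A × B × C) + 1)) := by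
    intro i
    rw [integral_finsetSum _ fun j _ => integrable_of_continuous (continuous_finsetSum _ fun c _ =>
      continuous_finsetSum _ fun c' _ => hcont i j c c')]
    refine Finset.sum_congr rfl fun j _ => ?_
    rw [integral_finsetSum _ fun c _ => integrable_of_continuous
      (continuous_finsetSum _ fun c' _ => hcont i j c c')]
    refine Finset.sum_congr rfl fun c _ => ?_
    rw [integral_finsetSum _ fun c' _ => integrable_of_continuous (hcont i j c c')]
    exact Finset.sum_congr rfl fun c' _ => integral_purity_term ψ hψ i j c c'
  simp only [hsum, ← Finset.sum_div, Finset.sum_add_distrib, Finset.sum_ite_eq, Finset.mem_univ,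
    if_true, Finset.sum_const, Finset.card_univ, nsmul_eq_mul, mul_ite, mul_one, mul_zero,
    Fintype.card_prod, Nat.cast_mul]
  have hne : Nonempty (A × B × C) := by
    by_contra h
    rw [not_nonempty_iff] at h
    simp at hψ
  obtain ⟨a, b, c⟩ := hne
  have hA : (0 : ℝ) < Fintype.card A := by exact_mod_cast Fintype.card_pos_iff.2 ⟨a⟩
  have hB : (0 : ℝ) < Fintype.card B := by exact_mod_cast Fintype.card_pos_iff.2 ⟨b⟩
  have hC : (0 : ℝ) < Fintype.card C := by exact_mod_cast Fintype.card_pos_iff.2 ⟨c⟩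
  field_simp
  ring

lemma continuous_purityDefect (m : ℝ) (ψ : A × B × C → ℂ) :
    Continuous fun U : unitaryGroup (A × B × C) ℂ => purityDefect m (U.1 *ᵥ ψ) := by
  have h := Complex.continuous_re.comp
    ((continuous_rhoAB ψ).matrix_mul (continuous_rhoAB ψ)).matrix_trace
  simp only [purityDefect]
  exact continuous_const.mul ((continuous_const.mul h).sub continuous_const)

lemma integral_purityDefect (m : ℝ) (ψ : A × B × C → ℂ) (hψ : ∑ x, ‖ψ x‖ ^ 2 = 1) :
    ∫ U : unitaryGroup (A × B × C) ℂ, purityDefect m (U.1 *ᵥ ψ) ∂haarUnitary (A × B × C)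
      = (m - 1) * (((Fintype.card C : ℝ) ^ 2 - 1)
        / (Fintype.card A * Fintype.card B * Fintype.card C + 1)) := by
  have h : Continuous fun U : unitaryGroup (A × B × C) ℂ =>
      (rhoAB (U.1 *ᵥ ψ) * rhoAB (U.1 *ᵥ ψ)).trace.re := Complex.continuous_re.comp
    ((continuous_rhoAB ψ).matrix_mul (continuous_rhoAB ψ)).matrix_trace
  simp only [purityDefect]
  rw [integral_const_mul, integral_sub ((integrable_of_continuous h).const_mul _)
    (integrable_const _), integral_const_mul, integral_purity ψ hψ]
  simp only [integral_const, probReal_univ, smul_eq_mul, mul_one]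
  have : (0 : ℝ) < Fintype.card A * Fintype.card B * Fintype.card C + 1 := by positivity
  field_simp
  ring

lemma integral_sqrt_purityDefect_le {m : ℝ} (hm : 1 ≤ m) (ψ : A × B × C → ℂ)
    (hψ : ∑ x, ‖ψ x‖ ^ 2 = 1) :
    ∫ U : unitaryGroup (A × B × C) ℂ, √(purityDefect m (U.1 *ᵥ ψ)) ∂haarUnitary (A × B × C)
      ≤ √(∫ U : unitaryGroup (A × B × C) ℂ, purityDefect m (U.1 *ᵥ ψ)
        ∂haarUnitary (A × B × C)) := by
  have hc := continuous_purityDefect m ψ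
  exact Real.strictConcaveOn_sqrt.concaveOn.le_map_integral Real.continuous_sqrt.continuousOn
    isClosed_Ici (Filter.Eventually.of_forall fun U =>
      purityDefect_nonneg _ (by rw [sum_norm_sq_mulVec, hψ]) hm)
    (integrable_of_continuous hc) (integrable_of_continuous hc.sqrt)

end Purity

/-! ## Continuity of the reflected entropy in the state -/

section Continuity

open scoped Matrix.Norms.L2Operator

/-- The operator norm makes matrices a C⋆-algebra, in which the functional calculus of a continuous
function depends continuously on the self-adjoint argument. -/
lemma continuous_cfc {T X : Type*} [TopologicalSpace T] [Fintype X] [DecidableEq X]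
    {a : T → Matrix X X ℂ} (ha : Continuous a) (ha' : ∀ t, (a t).IsHermitian) {f : ℝ → ℝ}
    (hf : Continuous f) : Continuous fun t => cfc f (a t) :=
  ha.cfc_of_mem_nhdsSet (s := Set.univ) f Filter.univ_mem (fun t => (ha' t).isSelfAdjoint)
    hf.continuousOn

variable {A B C : Type*} [Fintype A] [Fintype B] [Fintype C] [DecidableEq A] [DecidableEq B]
  [DecidableEq C]

lemma continuous_rhoAAstar {m : ℝ} (hm : 0 < m) (ψ : A × B × C → ℂ)
    (hψ : ∑ x, ‖ψ x‖ ^ 2 = 1) :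
    Continuous fun U : unitaryGroup (A × B × C) ℂ => rhoAAstar m (rhoAB (U.1 *ᵥ ψ)) := by
  have hpow : ∀ s : ℝ, 0 < s →
      Continuous fun U : unitaryGroup (A × B × C) ℂ => matPow (rhoAB (U.1 *ᵥ ψ)) s := fun s hs =>
    continuous_cfc (continuous_rhoAB ψ) (fun U => (posSemidef_rhoAB _).1)
      (Real.continuous_rpow_const hs.le)
  have hvec : Continuous fun U : unitaryGroup (A × B × C) ℂ =>
      (of fun i k => opVec (matPow (rhoAB (U.1 *ᵥ ψ)) (m / 2)) (i, k) :
        Matrix (A × A) (B × B) ℂ) :=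
    continuous_matrix fun i k => (hpow (m / 2) (half_pos hm)).matrix_elem _ _
  simp only [rhoAAstar, partialTrace_ketBra]
  refine ((hpow m hm).matrix_trace.inv₀ fun U h0 => ?_).smul
    (hvec.matrix_mul hvec.matrix_conjTranspose)
  have := trace_matPow_pos (posSemidef_rhoAB (U.1 *ᵥ ψ))
    (trace_rhoAB _ (by rw [sum_norm_sq_mulVec, hψ])) m
  rw [h0] at this
  exact lt_irrefl _ this

lemma continuous_reflectedEntropy {m n : ℝ} (hm : 0 < m) (hn : 1 ≤ n) (ψ : A × B × C → ℂ)
    (hψ : ∑ x, ‖ψ x‖ ^ 2 = 1) :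
    Continuous fun U : unitaryGroup (A × B × C) ℂ => reflectedEntropy m n (U.1 *ᵥ ψ) := by
  have hc := continuous_rhoAAstar hm ψ hψ
  have hnorm : ∀ U : unitaryGroup (A × B × C) ℂ, ∑ x, ‖(U.1 *ᵥ ψ) x‖ ^ 2 = 1 := fun U => by
    rw [sum_norm_sq_mulVec, hψ]
  have heq := fun U : unitaryGroup (A × B × C) ℂ =>
    rhoAAstar_eq (posSemidef_rhoAB (U.1 *ᵥ ψ)) (trace_rhoAB _ (hnorm U)) m
  have hp : ∀ U : unitaryGroup (A × B × C) ℂ, (rhoAAstar m (rhoAB (U.1 *ᵥ ψ))).PosSemidef :=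
    fun U => heq U ▸ posSemidef_self_mul_conjTranspose _
  simp only [reflectedEntropy, renyiEntropy]
  split_ifs with h
  · exact Complex.continuous_re.comp
      (continuous_cfc hc (fun U => (hp U).1) Real.continuous_negMulLog).matrix_trace
  · refine continuous_const.mul (Continuous.log (Complex.continuous_re.comp
      (continuous_cfc hc (fun U => (hp U).1)
        (Real.continuous_rpow_const (by linarith))).matrix_trace) fun U => ?_)
    -- The logarithm is continuous here because a state of trace one has `Tr σ ^ n > 0`.
    refine (trace_matPow_pos (hp U) ?_ n).ne'
    rw [heq, trace_purification_self (posSemidef_rhoAB _) (trace_rhoAB _ (hnorm U)) hm]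

end Continuity

end Reflected

theorem lemma1 (χA χB χC : ℕ) (hχ : χC < χA * χB)
    (ψ₀ : EuclideanSpace ℂ (Fin χA × Fin χB × Fin χC)) (hψ₀ : ‖ψ₀‖ = 1)
    (m : ℝ) (hm₁ : 1 ≤ m) (hm₂ : m ≤ 2) :
    (∀ n : ℝ, 1 < n →
      Integrable (fun U : Matrix.unitaryGroup (Fin χA × Fin χB × Fin χC) ℂ => |Reflected.reflectedEntropy 1 n (U.1 *ᵥ ψ₀.ofLp)
          - Reflected.reflectedEntropy m n (U.1 *ᵥ ψ₀.ofLp)|)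
        (Reflected.haarUnitary (Fin χA × Fin χB × Fin χC)) ∧
      ∫ U : Matrix.unitaryGroup (Fin χA × Fin χB × Fin χC) ℂ, |Reflected.reflectedEntropy 1 n (U.1 *ᵥ ψ₀.ofLp)
          - Reflected.reflectedEntropy m n (U.1 *ᵥ ψ₀.ofLp)|
        ∂(Reflected.haarUnitary (Fin χA × Fin χB × Fin χC))
        ≤ 2 * n / (n - 1) * √((m - 1) * χC / (χA * χB))
          * min ((χA : ℝ) ^ (2 * (n - 1))) ((χB : ℝ) ^ (2 * (n - 1)))) ∧
    (Integrable (fun U : Matrix.unitaryGroup (Fin χA × Fin χB × Fin χC) ℂ => |Reflected.reflectedEntropy 1 1 (U.1 *ᵥ ψ₀.ofLp)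
          - Reflected.reflectedEntropy m 1 (U.1 *ᵥ ψ₀.ofLp)|)
        (Reflected.haarUnitary (Fin χA × Fin χB × Fin χC)) ∧
      ∫ U : Matrix.unitaryGroup (Fin χA × Fin χB × Fin χC) ℂ, |Reflected.reflectedEntropy 1 1 (U.1 *ᵥ ψ₀.ofLp)
          - Reflected.reflectedEntropy m 1 (U.1 *ᵥ ψ₀.ofLp)|
        ∂(Reflected.haarUnitary (Fin χA × Fin χB × Fin χC))
        < 2 * √((m - 1) * χC / (χA * χB))
          * min (Real.log χA) (Real.log χB) + Real.log 2) := by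
  have hψ : ∑ x, ‖ψ₀.ofLp x‖ ^ 2 = 1 := by
    rw [← EuclideanSpace.norm_sq_eq, hψ₀, one_pow]
  have hnorm : ∀ U : Matrix.unitaryGroup (Fin χA × Fin χB × Fin χC) ℂ,
      ∑ x, ‖(U.1 *ᵥ ψ₀.ofLp) x‖ ^ 2 = 1 := fun U => by
    rw [Reflected.sum_norm_sq_mulVec, hψ]
  obtain ⟨hA, hB⟩ : 0 < χA ∧ 0 < χB := by
    have : 0 < χA * χB := by omega
    exact ⟨Nat.pos_of_mul_pos_right this, Nat.pos_of_mul_pos_left this⟩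
  have hA' : (0 : ℝ) < χA := by exact_mod_cast hA
  have hB' : (0 : ℝ) < χB := by exact_mod_cast hB
  have : Nonempty (Fin χA) := ⟨⟨0, hA⟩⟩
  have : Nonempty (Fin χB) := ⟨⟨0, hB⟩⟩
  have hm0 : 0 < m := by linarith
  have hint : ∀ n : ℝ, 1 ≤ n →
      Integrable (fun U : Matrix.unitaryGroup (Fin χA × Fin χB × Fin χC) ℂ =>
        |Reflected.reflectedEntropy 1 n (U.1 *ᵥ ψ₀.ofLp)
          - Reflected.reflectedEntropy m n (U.1 *ᵥ ψ₀.ofLp)|)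
        (Reflected.haarUnitary (Fin χA × Fin χB × Fin χC)) := fun n hn =>
    Reflected.integrable_of_continuous ((Reflected.continuous_reflectedEntropy one_pos hn _ hψ).sub
      (Reflected.continuous_reflectedEntropy hm0 hn _ hψ)).abs
  have hsqrt := Reflected.integral_sqrt_purityDefect_le hm₁ _ hψ
  have hsint := Reflected.integrable_of_continuous
    (Reflected.continuous_purityDefect m ψ₀.ofLp).sqrt
  rw [Reflected.integral_purityDefect m _ hψ] at hsqrt
  simp only [Fintype.card_fin] at hsqrt
  have hratio : ((χC : ℝ) ^ 2 - 1) / (χA * χB * χC + 1) < χC / (χA * χB) := by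
    rw [div_lt_div_iff₀ (by positivity) (by positivity)]
    have : 0 < (χA : ℝ) * χB := by positivity
    have : (0 : ℝ) ≤ χC := by positivity
    nlinarith
  have hδ : (m - 1) * (((χC : ℝ) ^ 2 - 1) / (χA * χB * χC + 1)) ≤ (m - 1) * χC / (χA * χB) := by
    rw [mul_div_assoc]
    exact mul_le_mul_of_nonneg_left hratio.le (by linarith)
  refine ⟨fun n hn => ⟨hint n hn.le, ?_⟩, hint 1 le_rfl, ?_⟩
  · have hn' : 0 < n - 1 := by linarith
    have h1 := integral_mono (hint n hn.le) ((hsint.const_mul (n / (n - 1))).mul_const _)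
      fun U => Reflected.abs_reflectedEntropy_sub_le _ (hnorm U) hm₁ hm₂ hn
    simp only [Fintype.card_fin] at h1
    rw [integral_mul_const, integral_const_mul] at h1
    refine h1.trans ?_
    -- The pointwise estimate carries `n / (n - 1)`, half of the stated constant.
    gcongr
    · linarith
    · exact hsqrt.trans (Real.sqrt_le_sqrt hδ)
  · have hlogA := Real.log_natCast_nonneg χA
    have hlogB := Real.log_natCast_nonneg χB
    have hlog2 := Real.log_pos one_lt_two
    -- Strictness comes from `hratio`, which needs `m > 1` and both logarithms positive; in the
    -- excluded cases the left side is zero and `ln 2 > 0` suffices.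
    by_cases hcard : χA = 1 ∨ χB = 1
    · have hz : ∀ (U : Matrix.unitaryGroup (Fin χA × Fin χB × Fin χC) ℂ) (r : ℝ), 0 < r →
          Reflected.reflectedEntropy r 1 (U.1 *ᵥ ψ₀.ofLp) = 0 := fun U r hr =>
        Reflected.reflectedEntropy_one_eq_zero _ (hnorm U) hr (by simpa using hcard)
      simp only [hz _ _ one_pos, hz _ _ hm0, sub_zero, abs_zero, integral_zero]
      positivity
    rcases hm₁.eq_or_lt with rfl | hm
    · simp only [sub_self, abs_zero, integral_zero]
      positivity
    push Not at hcard
    have h1 := integral_mono (hint 1 le_rfl)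
      (((hsint.const_mul 2).mul_const _).add (integrable_const (Real.log 2)))
      fun U => Reflected.abs_reflectedEntropy_one_sub_le _ (hnorm U) hm₁ hm₂
    have hmin : 0 < min (Real.log χA) (Real.log χB) :=
      lt_min (Real.log_pos (by exact_mod_cast (by omega : 1 < χA)))
        (Real.log_pos (by exact_mod_cast (by omega : 1 < χB)))
    simp only [Fintype.card_fin, Pi.add_apply] at h1
    rw [integral_add ((hsint.const_mul 2).mul_const _) (integrable_const _), integral_mul_const,
      integral_const_mul] at h1
    simp only [integral_const, probReal_univ, smul_eq_mul, one_mul] at h1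
    refine h1.trans_lt ?_
    have hC : 0 < χC := by
      rcases Nat.eq_zero_or_pos χC with rfl | h
      -- For `χC = 0` the space is zero and contains no unit vector.
      · simp at hψ
      · exact h
    have hlt : √((m - 1) * (((χC : ℝ) ^ 2 - 1) / (χA * χB * χC + 1)))
        < √((m - 1) * χC / (χA * χB)) := by
      have hC' : (1 : ℝ) ≤ χC := by exact_mod_cast hC
      refine Real.sqrt_lt_sqrt (mul_nonneg (by linarith) (div_nonneg (by nlinarith)
        (by positivity))) ?_
      rw [mul_div_assoc]
      exact mul_lt_mul_of_pos_left hratio (by linarith)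
    have := hsqrt.trans_lt hlt
    gcongr
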